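/- Let $N\in\mathbb N$, let $p^N(x)=(2\pi)^{-N/2}e^{-|x|^2/2}$ be the density of the standard Gaussian measure $\mu^N$ on $\mathbb R^N$, and let $$L=-\sum_{i=1}^N\frac{\partial^2}{\partial x_i^2}+\sum_{i=1}^N x_i\frac{\partial}{\partial x_i}$$ be the Ornstein–Uhlenbeck operator, a nonnegative self-adjoint operator in $L^2(\mu^N)$. Functions and distributions are real-valued or complex-valued. For $s\in\mathbb R$ let $\mathbb D^{(N)}_{2,s}$ be the completion of $\{f\in L^2(\mu^N):\|f\|_{2,s}<\infty\}$ for the norm $$\|f\|_{2,s}=\|(1+L)^{s/2}f\|_{L^2(\mu^N)},$$ regarded as a space of distributions on $\mathbb R^N$: its elements are the limits, in the sense of distributions, of $\|\cdot\|_{2,s}$-Cauchy sequences of such $f$, a function $f$ being identified with the distribution $\varphi\mapsto\int f\varphi\,dx$. Put $$\mathbb D^{(N)}_{2,\infty}=\bigcap_{s>0}\mathbb D^{(N)}_{2,s},\qquad \mathbb D^{(N)}_{2,-\infty}=\bigcup_{s<0}\mathbb D^{(N)}_{2,s}.$$ Let $\mathcal S$ be the Schwartz space on $\mathbb R^N$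 and $\mathcal S'$ its topological dual, the space of tempered distributions. Then for every distribution $X$ on $\mathbb R^N$, $$X\,(p^N)^{1/2}\in\mathcal S\iff X\in\mathbb D^{(N)}_{2,\infty},$$ $$X\,(p^N)^{1/2}\in\mathcal S'\iff X\in\mathbb D^{(N)}_{2,-\infty}.$$ -/

import Mathlib

open MeasureTheory Filter Topology
open scoped Distributions SchwartzMap ContDiff

noncomputable section

namespace DiscreteWiener

/-- The Euclidean space `ℝ^N`. -/
abbrev Space (N : ℕ) : Type := EuclideanSpace ℝ (Fin N)

/-- `C_c^∞(ℝ^N; ℝ)`. -/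
abbrev Test (N : ℕ) : Type := 𝓓((⊤ : TopologicalSpace.Opens (Space N)), ℝ)

/-- The `𝕜`-valued distributions on `ℝ^N` (with `𝕜 = ℝ` or `ℂ`): the largest space of objects `X`
that can be multiplied by the smooth positive function `(p^N)^{1/2}`. A locally integrable function
`f` is identified with the distribution `φ ↦ ∫ φ f dx` (Lebesgue measure). -/
abbrev Distr (N : ℕ) (𝕜 : Type*) [RCLike 𝕜] : Type _ :=
  𝓓'((⊤ : TopologicalSpace.Opens (Space N)), 𝕜)

/-- The density `p^N(x) = (2π)^{-N/2} exp(-|x|²/2)`. -/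
def density (N : ℕ) (x : Space N) : ℝ :=
  (2 * Real.pi) ^ (-(N : ℝ) / 2) * Real.exp (-‖x‖ ^ 2 / 2)

/-- The standard Gaussian measure `μ^N` on `ℝ^N`. -/
def gaussian (N : ℕ) : Measure (Space N) :=
  (volume : Measure (Space N)).withDensity (fun x => ENNReal.ofReal (density N x))

/-- `L²(μ^N)` with values in `𝕜`. -/
abbrev L2 (N : ℕ) (𝕜 : Type*) [RCLike 𝕜] : Type _ := Lp 𝕜 2 (gaussian N)

lemma density_pos (N : ℕ) (x : Space N) : 0 < density N x := by
  unfold density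
  positivity

lemma contDiff_density (N : ℕ) : ContDiff ℝ ∞ (density N) := by
  unfold density
  exact contDiff_const.mul (((contDiff_norm_sq ℝ).neg.div_const 2).exp)

lemma contDiff_sqrt_density (N : ℕ) : ContDiff ℝ ∞ (fun x => Real.sqrt (density N x)) :=
  (contDiff_density N).sqrt (fun x => (density_pos N x).ne')

/-- Multiplication `φ ↦ (p^N)^{1/2} φ` of test functions. -/
def mulSqrtTest (N : ℕ) : Test N →ₗ[ℝ] Test N where
  toFun φ :=
    { toFun := fun x => Real.sqrt (density N x) * φ x
      contDiff' := (contDiff_sqrt_density N).mul φ.contDiff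
      hasCompactSupport' := φ.hasCompactSupport.mul_left
      tsupport_subset' := fun _ _ => trivial }
  map_add' φ ψ := by
    ext x
    exact mul_add _ _ _
  map_smul' c φ := by
    ext x
    exact mul_left_comm _ _ _

/-- The product `X (p^N)^{1/2}` of a distribution and a smooth function:
`⟨X (p^N)^{1/2}, φ⟩ = ⟨X, (p^N)^{1/2} φ⟩`. -/
def mulSqrt {N : ℕ} {𝕜 : Type*} [RCLike 𝕜] (X : Distr N 𝕜) : Test N →ₗ[ℝ] 𝕜 :=
  (X : Test N →ₗ[ℝ] 𝕜) ∘ₗ mulSqrtTest N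

/-- A test function as a `𝕜`-valued Schwartz function. -/
def testToSchwartz {N : ℕ} (𝕜 : Type*) [RCLike 𝕜] (φ : Test N) : 𝓢(Space N, 𝕜) :=
  HasCompactSupport.toSchwartzMap (f := fun x => ((φ x : ℝ) : 𝕜))
    (φ.hasCompactSupport.comp_left (g := fun r : ℝ => (r : 𝕜)) (by simp))
    ((RCLike.ofRealCLM (K := 𝕜)).contDiff.comp φ.contDiff)

/-- The functional `T` on test functions is (given by) a Schwartz function. -/
def IsSchwartz {N : ℕ} {𝕜 : Type*} [RCLike 𝕜] (T : Test N →ₗ[ℝ] 𝕜) : Prop :=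
  ∃ ψ : 𝓢(Space N, 𝕜), ∀ φ : Test N, T φ = ∫ x, φ x • ψ x

/-- The functional `T` on test functions is (the restriction of) a tempered distribution, i.e. of an
element of the topological dual of the Schwartz space. -/
def IsTempered {N : ℕ} {𝕜 : Type*} [RCLike 𝕜] (T : Test N →ₗ[ℝ] 𝕜) : Prop :=
  ∃ U : 𝓢(Space N, 𝕜) →L[𝕜] 𝕜, ∀ φ : Test N, T φ = U (testToSchwartz 𝕜 φ)

/-- The partial derivative `∂φ/∂x_i`. -/
def partialDeriv {N : ℕ} (i : Fin N) (φ : Space N → ℝ) (x : Space N) : ℝ :=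
  fderiv ℝ φ x (EuclideanSpace.single i 1)

/-- The Ornstein–Uhlenbeck differential operator `L = -∑ ∂²/∂x_i² + ∑ x_i ∂/∂x_i`. -/
def ornsteinUhlenbeck {N : ℕ} (φ : Space N → ℝ) (x : Space N) : ℝ :=
  -∑ i, partialDeriv i (partialDeriv i φ) x + ∑ i, x i * partialDeriv i φ x

/-- `f` lies in the domain of the self-adjoint realization of `L` in `L²(μ^N)`, and `L f = g`.
The operator `L` on `C_c^∞` is symmetric and essentially self-adjoint in `L²(μ^N)`; its unique
self-adjoint extension is its adjoint, that is, `L` in the sense of distributions. -/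
def IsOU {N : ℕ} {𝕜 : Type*} [RCLike 𝕜] (f g : L2 N 𝕜) : Prop :=
  ∀ φ : Test N, ∫ x, ornsteinUhlenbeck φ x • f x ∂(gaussian N) = ∫ x, φ x • g x ∂(gaussian N)

/-- `f` lies in the domain of `(1 + L)^{s/2}`, and `(1 + L)^{s/2} f = g`, by the spectral calculus of
the nonnegative self-adjoint operator `L`, whose spectrum is pure point: for every eigenvalue `r`,
the components of `f` and `g` in the eigenspace of `r` satisfy `J_r g = (1 + r)^{s/2} J_r f`. -/
def IsOUPower {N : ℕ} {𝕜 : Type*} [RCLike 𝕜] (s : ℝ) (f g : L2 N 𝕜) : Prop :=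
  ∀ (r : ℝ) (h : L2 N 𝕜), IsOU h ((r : 𝕜) • h) →
    inner 𝕜 h g = (((1 + r) ^ (s / 2) : ℝ) : 𝕜) * inner 𝕜 h f

/-- The Sobolev space `𝔻_{2,s}`: the completion of
`{f ∈ L²(μ^N) : ‖f‖_{2,s} < ∞}` for the norm `‖f‖_{2,s} = ‖(1 + L)^{s/2} f‖_{L²(μ^N)}`, realized
in the space of distributions. Its elements are the limits `X`, in the sense of distributions, of the
sequences `f n` that are Cauchy for `‖·‖_{2,s}`; here `g n = (1 + L)^{s/2} (f n)`, so
`‖f n - f m‖_{2,s} = ‖g n - g m‖`. -/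
def sobolev (N : ℕ) (𝕜 : Type*) [RCLike 𝕜] (s : ℝ) : Set (Distr N 𝕜) :=
  {X | ∃ f g : ℕ → L2 N 𝕜, (∀ n, IsOUPower s (f n) (g n)) ∧ CauchySeq g ∧
    ∀ φ : Test N, Tendsto (fun n => ∫ x, φ x • f n x) atTop (𝓝 (X φ))}

/-- `𝔻_{2,∞} = ⋂_{s > 0} 𝔻_{2,s}`. -/
def sobolevTop (N : ℕ) (𝕜 : Type*) [RCLike 𝕜] : Set (Distr N 𝕜) :=
  ⋂ (s : ℝ) (_ : 0 < s), sobolev N 𝕜 s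

/-- `𝔻_{2,-∞} = ⋃_{s < 0} 𝔻_{2,s}`. -/
def sobolevBot (N : ℕ) (𝕜 : Type*) [RCLike 𝕜] : Set (Distr N 𝕜) :=
  ⋃ (s : ℝ) (_ : s < 0), sobolev N 𝕜 s

end DiscreteWiener

end

/-! Multiplication by `(p^N)^{1/2}` is an isometry of `L²(μ^N)` onto `L²(dx)` that conjugates `L` to
the number operator `H = ∑ a_i* a_i`, where `a_i = ∂_i + x_i/2`. The commutation relations of the
`a_i` and their adjoints give finite-dimensional spaces `E_n` of Hermite functions on which `H = n`.
These are mutually orthogonal and total in `L²(dx)` (`eq_zero_of_inner_hermiteSpace`), so `(1 +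
L)^{s/2}` is just the weight `(1 + n)^{s/2}` on the component in `E_n` (`isOUPower_iff`).

What remains is the sequence description of `𝓢` and `𝓢'`. The components of a Schwartz function
decrease rapidly, because `(1 + H)^k` is symmetric and preserves `𝓢`
(`norm_hermiteProj_schwartz_le`). Conversely, on `E_n` every Schwartz seminorm is at most a
polynomial in `n` times the `L²` norm (`polyBounded_seminorm`): the Sobolev embedding reduces this
to `L²` norms of polynomials in `x_i` and `∂_i`, which are combinations of ladder operators, and
each ladder operator costs a factor of order `√n`. Hence a rapidly decreasing expansion converges in
`𝓢` (`exists_hasSum_hermiteComp`), which gives the first equivalence.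

For the second, a tempered distribution restricted to `E_n` is represented by a vector of
polynomially bounded norm, so a sufficiently negative weight makes the series of these vectors
converge. Conversely, an element of some `𝔻_{2,s}` is obtained by pairing a fixed `L²` vector with
`(1 + H)^k φ`, which is continuous in `φ ∈ 𝓢`. -/

noncomputable section

namespace DiscreteWiener

/-! ### Schwartz seminorms, series in the Schwartz space, and cut-offs -/

section SchwartzGeneral

open SchwartzMap LineDeriv

lemma norm_multilinear_le_sum {N n : ℕ} {F : Type*} [NormedAddCommGroup F] [NormedSpace ℝ F]
    (T : ContinuousMultilinearMap ℝ (fun _ : Fin n => Space N) F) :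
    ‖T‖ ≤ ∑ I : Fin n → Fin N, ‖T fun j => EuclideanSpace.single (I j) 1‖ := by
  refine T.opNorm_le_bound (by positivity) fun v => ?_
  have h : T v = ∑ I : Fin n → Fin N,
      T fun j => v j (I j) • (EuclideanSpace.single (I j) 1 : Space N) := by
    have := T.toMultilinearMap.map_sum
      (fun (j : Fin n) (i : Fin N) => v j i • (EuclideanSpace.single i 1 : Space N))
    simp only [ContinuousMultilinearMap.coe_coe] at this
    rw [← this]
    congr 1
    ext j
    have := (EuclideanSpace.basisFun (Fin N) ℝ).sum_repr (v j)
    simp only [EuclideanSpace.basisFun_repr, EuclideanSpace.basisFun_apply] at this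
    rw [this]
  rw [h, Finset.sum_mul]
  refine (norm_sum_le _ _).trans (Finset.sum_le_sum fun I _ => ?_)
  rw [T.map_smul_univ, norm_smul, mul_comm, norm_prod]
  gcongr with j
  exact PiLp.norm_apply_le (v j) (I j)

variable {N : ℕ} {𝕜 : Type*} [RCLike 𝕜]

/-- Reduces every Schwartz seminorm to suprema of coordinate derivatives with polynomial weights.
The weight `‖x‖ ^ k` is replaced by `1 + ‖x‖ ^ (2k)` because only even powers of the norm are
polynomials in the coordinates. -/
lemma seminorm_le_sum (k n : ℕ) (ψ : 𝓢(Space N, 𝕜)) :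
    SchwartzMap.seminorm 𝕜 k n ψ ≤ ∑ I : Fin n → Fin N,
      (SchwartzMap.seminorm 𝕜 0 0
          (∂^{fun j => (EuclideanSpace.single (I j) 1 : Space N)} ψ) +
        SchwartzMap.seminorm 𝕜 0 0 (smulLeftCLM 𝕜 (fun x : Space N => (‖x‖ ^ 2) ^ k)
          (∂^{fun j => (EuclideanSpace.single (I j) 1 : Space N)} ψ))) := by
  refine SchwartzMap.seminorm_le_bound 𝕜 k n ψ (by positivity) fun x => ?_
  refine (mul_le_mul_of_nonneg_left (norm_multilinear_le_sum _) (by positivity)).trans ?_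
  rw [Finset.mul_sum]
  refine Finset.sum_le_sum fun I _ => ?_
  rw [← iteratedLineDerivOp_eq_iteratedFDeriv]
  set φ := ∂^{fun j => (EuclideanSpace.single (I j) 1 : Space N)} ψ
  have h1 := SchwartzMap.norm_le_seminorm 𝕜 φ x
  have hg : (fun x : Space N => (‖x‖ ^ 2) ^ k).HasTemperateGrowth :=
    (Function.hasTemperateGrowth_norm_sq (Space N)).pow k
  have h2 := SchwartzMap.norm_le_seminorm 𝕜
    (smulLeftCLM 𝕜 (fun x : Space N => (‖x‖ ^ 2) ^ k) φ) x
  rw [smulLeftCLM_apply_apply hg, norm_smul, Real.norm_of_nonneg (by positivity)] at h2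
  have h3 : ‖x‖ ^ k ≤ 1 + (‖x‖ ^ 2) ^ k := by
    nlinarith [sq_nonneg (‖x‖ ^ k - 1), sq_nonneg (‖x‖ ^ k), pow_right_comm ‖x‖ 2 k,
      pow_nonneg (norm_nonneg x) k]
  calc ‖x‖ ^ k * ‖φ x‖ ≤ (1 + (‖x‖ ^ 2) ^ k) * ‖φ x‖ := by gcongr
    _ ≤ _ := by linarith

/-- The Weierstrass test applied to all derivatives makes the pointwise sum smooth, with termwise
derivatives. Each seminorm of a remainder is then at most the tail of the corresponding summable
series. -/
lemma hasSum_of_summable_seminorm {ι E F : Type*} [NormedAddCommGroup E] [NormedSpace ℝ E]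
    [NormedAddCommGroup F] [NormedSpace ℝ F] [CompleteSpace F] (f : ι → 𝓢(E, F))
    (hf : ∀ k n, Summable fun j => SchwartzMap.seminorm ℝ k n (f j)) :
    ∃ ψ : 𝓢(E, F), HasSum f ψ := by
  have hsm : ∀ i, ContDiff ℝ ((⊤ : ℕ∞) : WithTop ℕ∞) (f i) := fun i => (f i).smooth ⊤
  have hb : ∀ (k : ℕ) (i : ι) (x : E), (k : ℕ∞) ≤ ⊤ →
      ‖iteratedFDeriv ℝ k (f i) x‖ ≤ SchwartzMap.seminorm ℝ 0 k (f i) :=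
    fun k i x _ => norm_iteratedFDeriv_le_seminorm ℝ (f i) k x
  have hder : ∀ (n : ℕ) (x : E), iteratedFDeriv ℝ n (fun y => ∑' j, f j y) x =
      ∑' j, iteratedFDeriv ℝ n (f j) x := fun n x =>
    iteratedFDeriv_tsum_apply hsm (fun k _ => hf 0 k) hb le_top x
  have hsum : ∀ (n : ℕ) (x : E), Summable fun j => iteratedFDeriv ℝ n (f j) x := fun n x =>
    Summable.of_norm_bounded (hf 0 n) fun j => hb n j x le_top
  have hsumn : ∀ (k n : ℕ) (x : E), Summable fun j => ‖x‖ ^ k * ‖iteratedFDeriv ℝ n (f j) x‖ :=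
    fun k n x => Summable.of_nonneg_of_le (fun j => by positivity)
      (fun j => le_seminorm ℝ k n (f j) x) (hf k n)
  let ψ : 𝓢(E, F) :=
    { toFun := fun y => ∑' j, f j y
      smooth' := contDiff_tsum hsm (fun k _ => hf 0 k) hb
      decay' := fun k n => ⟨∑' j, SchwartzMap.seminorm ℝ k n (f j), fun x => by
        rw [hder]
        have h1 : Summable fun j => ‖iteratedFDeriv ℝ n (f j) x‖ := by
          simpa using hsumn 0 n x
        refine (mul_le_mul_of_nonneg_left (norm_tsum_le_tsum_norm h1) (by positivity)).trans ?_
        rw [← tsum_mul_left]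
        exact (hsumn k n x).tsum_le_tsum (fun j => le_seminorm ℝ k n (f j) x) (hf k n)⟩ }
  refine ⟨ψ, ?_⟩
  rw [HasSum, (schwartz_withSeminorms ℝ E F).tendsto_nhds]
  rintro ⟨k, n⟩ ε hε
  have hlim := (hf k n).hasSum
  have htail : ∀ᶠ s : Finset ι in atTop,
      ∑' j, SchwartzMap.seminorm ℝ k n (f j) - ∑ j ∈ s, SchwartzMap.seminorm ℝ k n (f j) < ε := by
    have := hlim.eventually (lt_mem_nhds (show _ - ε < _ by linarith))
    filter_upwards [this] with s hs
    linarith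
  filter_upwards [htail] with s hs
  refine lt_of_le_of_lt ?_ hs
  refine seminorm_le_bound ℝ k n _ ?_ fun x => ?_
  · rw [sub_nonneg]
    exact (hf k n).sum_le_tsum s fun j _ => apply_nonneg _ _
  have hfin : iteratedFDeriv ℝ n (⇑(∑ j ∈ s, f j - ψ)) x =
      ∑ j ∈ s, iteratedFDeriv ℝ n (f j) x - ∑' j, iteratedFDeriv ℝ n (f j) x := by
    rw [← hder]
    have h1 : (⇑(∑ j ∈ s, f j - ψ) : E → F) = (fun y => ∑ j ∈ s, f j y) - ⇑ψ := by
      ext y; simp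
    rw [h1, iteratedFDeriv_sub_apply]
    · congr 1
      rw [iteratedFDeriv_fun_sum_apply]
      exact fun j _ => ((f j).smooth n).contDiffAt
    · exact (ContDiff.sum fun j _ => (f j).smooth n).contDiffAt
    · exact (ψ.smooth n).contDiffAt
  rw [hfin, ← (hsum n x).sum_add_tsum_compl (s := s), sub_add_cancel_left, norm_neg]
  have h1 : Summable fun j => ‖iteratedFDeriv ℝ n (f j) x‖ := by simpa using hsumn 0 n x
  have h2 := h1.subtype ((s : Set ι)ᶜ)
  refine (mul_le_mul_of_nonneg_left (norm_tsum_le_tsum_norm h2) (by positivity)).trans ?_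
  rw [← tsum_mul_left, ← (hf k n).sum_add_tsum_compl (s := s), add_sub_cancel_left]
  exact ((hsumn k n x).subtype _).tsum_le_tsum (fun j => le_seminorm ℝ k n (f j) x)
    ((hf k n).subtype _)

/-- The approximants are `χ(εx) ψ(x)` with `ε = 1/(m+1)`. Every derivative of `χ(εx) - 1` is `O(ε (1
+ ‖x‖))`, and the extra factor `1 + ‖x‖` is absorbed by a seminorm of `ψ` with one more power of
`‖x‖`. -/
lemma exists_compactSupport_tendsto {E F : Type*} [NormedAddCommGroup E] [InnerProductSpace ℝ E]
    [FiniteDimensional ℝ E] [NormedAddCommGroup F] [NormedSpace ℝ F] (ψ : 𝓢(E, F)) :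
    ∃ φ : ℕ → 𝓢(E, F), (∀ m, HasCompactSupport (φ m)) ∧ Tendsto φ atTop (𝓝 ψ) := by
  let χ : ContDiffBump (0 : E) := ⟨1, 2, one_pos, one_lt_two⟩
  have hχ : ContDiff ℝ ∞ χ := χ.contDiff
  let χs : 𝓢(E, ℝ) := χ.hasCompactSupport.toSchwartzMap hχ
  let g : E → ℝ := fun x => χ x - 1
  have hg : ContDiff ℝ ∞ g := hχ.sub contDiff_const
  -- For `i = 0` the function vanishes when `‖εx‖ ≤ 1` and is otherwise at most `1 ≤ ε‖x‖` in
  -- absolute value. For `i > 0` the chain rule gives `ε ^ i ≤ ε`.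
  have hbound : ∀ i : ℕ, ∃ C : ℝ, 0 ≤ C ∧ ∀ ε : ℝ, 0 < ε → ε ≤ 1 → ∀ x : E,
      ‖iteratedFDeriv ℝ i (fun y => g (ε • y)) x‖ ≤ ε * C * (1 + ‖x‖) := by
    intro i
    rcases Nat.eq_zero_or_pos i with rfl | hi
    · refine ⟨1, zero_le_one, fun ε hε hε1 x => ?_⟩
      rw [norm_iteratedFDeriv_zero]
      by_cases h : ‖ε • x‖ ≤ 1
      · have : χ (ε • x) = 1 := χ.one_of_mem_closedBall (by simpa using! h)
        simp only [g, this, sub_self, norm_zero]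
        positivity
      · have h1 := χ.nonneg (x := ε • x)
        have h2 := χ.le_one (x := ε • x)
        rw [norm_smul, Real.norm_of_nonneg hε.le] at h
        rw [Real.norm_eq_abs, abs_le]
        constructor <;> simp only [g] <;> nlinarith
    · refine ⟨SchwartzMap.seminorm ℝ 0 i χs, apply_nonneg _ _, fun ε hε hε1 x => ?_⟩
      rw [iteratedFDeriv_comp_const_smul ε (hg.of_le (by exact_mod_cast le_top)), norm_smul]
      have h1 : iteratedFDeriv ℝ i g (ε • x) = iteratedFDeriv ℝ i χs (ε • x) := by
        have : g = ⇑χs - fun _ => (1 : ℝ) := rfl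
        rw [this, iteratedFDeriv_sub_apply (χs.smooth i).contDiffAt contDiff_const.contDiffAt,
          iteratedFDeriv_const_of_ne hi.ne', Pi.zero_apply, sub_zero]
      rw [h1, norm_pow, Real.norm_of_nonneg hε.le]
      have h2 := norm_iteratedFDeriv_le_seminorm ℝ χs i (ε • x)
      have h3 : ε ^ i ≤ ε := pow_le_of_le_one hε.le hε1 hi.ne'
      have h4 : (0 : ℝ) ≤ SchwartzMap.seminorm ℝ 0 i χs := apply_nonneg _ _
      calc ε ^ i * ‖iteratedFDeriv ℝ i χs (ε • x)‖ ≤ ε * SchwartzMap.seminorm ℝ 0 i χs := by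
            gcongr
        _ ≤ _ := le_mul_of_one_le_right (by positivity) (by linarith [norm_nonneg x])
  choose C hC0 hC using hbound
  have hε : ∀ m : ℕ, (0 : ℝ) < 1 / (m + 1) := fun m => by positivity
  have hε1 : ∀ m : ℕ, (1 : ℝ) / (m + 1) ≤ 1 := fun m => by
    rw [div_le_one (by positivity)]; linarith [(Nat.cast_nonneg m : (0 : ℝ) ≤ m)]
  have hcs : ∀ m : ℕ, HasCompactSupport fun x => χ ((1 / (m + 1) : ℝ) • x) • ψ x := fun m =>
    HasCompactSupport.smul_right (χ.hasCompactSupport.comp_smul (hε m).ne')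
  have hcd : ∀ m : ℕ, ContDiff ℝ ∞ fun x => χ ((1 / (m + 1) : ℝ) • x) • ψ x := fun m =>
    (hχ.comp (contDiff_const_smul _)).smul (ψ.smooth ⊤)
  refine ⟨fun m => (hcs m).toSchwartzMap (hcd m), fun m => hcs m, ?_⟩
  rw [(schwartz_withSeminorms ℝ E F).tendsto_nhds]
  rintro ⟨k, n⟩ δ hδ
  let K : ℝ := ∑ i ∈ Finset.range (n + 1), n.choose i * C i *
    (SchwartzMap.seminorm ℝ k (n - i) ψ + SchwartzMap.seminorm ℝ (k + 1) (n - i) ψ)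
  have hK : 0 ≤ K := Finset.sum_nonneg fun i _ => by have := hC0 i; positivity
  have hle : ∀ m : ℕ, SchwartzMap.seminorm ℝ k n ((hcs m).toSchwartzMap (hcd m) - ψ) ≤
      1 / (m + 1) * K := by
    intro m
    refine seminorm_le_bound ℝ k n _ (by have := hε m; positivity) fun x => ?_
    have h1 : (⇑((hcs m).toSchwartzMap (hcd m) - ψ) : E → F) =
        fun y => g ((1 / (m + 1) : ℝ) • y) • ψ y := by
      ext y
      change χ ((1 / (m + 1) : ℝ) • y) • ψ y - ψ y = (χ ((1 / (m + 1) : ℝ) • y) - 1) • ψ y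
      rw [sub_smul, one_smul]
    rw [h1]
    have h2 := norm_iteratedFDeriv_smul_le (𝕜 := ℝ) (N := ∞) (n := n)
      (hg.comp (contDiff_const_smul (1 / (m + 1) : ℝ))) (ψ.smooth ⊤) x (by exact_mod_cast le_top)
    refine (mul_le_mul_of_nonneg_left h2 (by positivity)).trans ?_
    rw [Finset.mul_sum, Finset.mul_sum]
    refine Finset.sum_le_sum fun i _ => ?_
    have h3 := hC i _ (hε m) (hε1 m) x
    have h4 := le_seminorm ℝ k (n - i) ψ x
    have h5 := le_seminorm ℝ (k + 1) (n - i) ψ x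
    have := hC0 i
    have := hε m
    calc ‖x‖ ^ k * (n.choose i * ‖iteratedFDeriv ℝ i (g ∘ fun y => (1 / (m + 1) : ℝ) • y) x‖ *
          ‖iteratedFDeriv ℝ (n - i) ψ x‖)
        ≤ ‖x‖ ^ k * (n.choose i * (1 / (m + 1) * C i * (1 + ‖x‖)) *
          ‖iteratedFDeriv ℝ (n - i) ψ x‖) := by gcongr; exact h3
      _ = 1 / (m + 1) * (n.choose i * C i * (‖x‖ ^ k * ‖iteratedFDeriv ℝ (n - i) ψ x‖ +
          ‖x‖ ^ (k + 1) * ‖iteratedFDeriv ℝ (n - i) ψ x‖)) := by ring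
      _ ≤ _ := by gcongr
  have hlim : Tendsto (fun m : ℕ => 1 / ((m : ℝ) + 1) * K) atTop (𝓝 0) := by
    simpa using tendsto_one_div_add_atTop_nhds_zero_nat.mul_const K
  filter_upwards [hlim.eventually (gt_mem_nhds hδ)] with m hm
  exact (hle m).trans_lt hm

end SchwartzGeneral

/-! ### Sobolev embedding through the Fourier transform -/

section SobolevEmbedding

open SchwartzMap LineDeriv FourierTransform Laplacian
open scoped ENNReal

variable {N : ℕ} {𝕜 : Type*} [RCLike 𝕜]

lemma norm_toComplex (z : 𝕜) : ‖RCLike.map 𝕜 ℂ z‖ = ‖z‖ := by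
  rw [← sq_eq_sq₀ (norm_nonneg _) (norm_nonneg _), RCLike.norm_sq_eq_def, RCLike.norm_sq_eq_def]
  simp [RCLike.map_apply]

/-- The operator `1 - (2π)⁻² Δ`. -/
def bessel (N : ℕ) (𝕜 : Type*) [RCLike 𝕜] : 𝓢(Space N, 𝕜) →L[𝕜] 𝓢(Space N, 𝕜) :=
  ContinuousLinearMap.id 𝕜 _ -
    (((2 * Real.pi) ^ 2)⁻¹ : ℝ) • ∑ i, (lineDerivOpCLM 𝕜 𝓢(Space N, 𝕜)
      (EuclideanSpace.single i (1 : ℝ) : Space N)) ∘L (lineDerivOpCLM 𝕜 𝓢(Space N, 𝕜)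
      (EuclideanSpace.single i (1 : ℝ) : Space N))

lemma bessel_apply (ψ : 𝓢(Space N, 𝕜)) : bessel N 𝕜 ψ = ψ - (((2 * Real.pi) ^ 2)⁻¹ : ℝ) •
    ∑ i, ∂_{(EuclideanSpace.single i (1 : ℝ) : Space N)}
      (∂_{(EuclideanSpace.single i (1 : ℝ) : Space N)} ψ) := by
  simp [bessel]

lemma hasTemperateGrowth_one_add_sq_pow (k : ℕ) :
    (fun x : Space N => (1 + ‖x‖ ^ 2) ^ k).HasTemperateGrowth :=
  ((Function.HasTemperateGrowth.const (1 : ℝ)).add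
    (Function.hasTemperateGrowth_norm_sq (Space N))).pow k

/-- The Fourier symbol of `Δ` is `-(2π)²‖x‖²`, which is why `bessel` carries the factor `(2π)⁻²`. -/
lemma bessel_iterate_eq (k : ℕ) (ψ : 𝓢(Space N, ℂ)) :
    (bessel N ℂ)^[k] ψ = fourierMultiplierCLM ℂ (fun x : Space N => (1 + ‖x‖ ^ 2) ^ k) ψ := by
  have h1 : ∀ φ : 𝓢(Space N, ℂ),
      bessel N ℂ φ = fourierMultiplierCLM ℂ (fun x : Space N => (1 + ‖x‖ ^ 2) ^ 1) φ := by
    intro φ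
    have h2 := laplacian_eq_sum (EuclideanSpace.basisFun (Fin N) ℝ) φ
    simp only [EuclideanSpace.basisFun_apply] at h2
    rw [bessel_apply, ← h2, laplacian_eq_fourierMultiplierCLM]
    have h3 : (fun x : Space N => (1 + ‖x‖ ^ 2) ^ 1) = fun x => 1 + ‖x‖ ^ 2 := by
      ext x; ring
    rw [h3, fourierMultiplierCLM_apply, fourierMultiplierCLM_apply]
    have h4 := smulLeftCLM_add (F := ℂ) (Function.HasTemperateGrowth.const (1 : ℝ))
      (Function.hasTemperateGrowth_norm_sq (Space N))
    have h5 : (fun x : Space N => 1 + ‖x‖ ^ 2) = (fun _ => (1 : ℝ)) + fun x => ‖x‖ ^ 2 := rfl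
    rw [h5, h4, add_apply, fourierInv_add]
    simp only [smulLeftCLM_const, one_smul, ContinuousLinearMap.coe_id', id_eq]
    rw [smul_smul]
    have : ((2 * Real.pi) ^ 2)⁻¹ * -(2 * Real.pi) ^ 2 = -1 := by
      have := Real.pi_pos
      field_simp
    rw [this, neg_one_smul, sub_neg_eq_add]
    simp
  induction k with
  | zero =>
    simp only [Function.iterate_zero, id_eq, pow_zero]
    exact (by simp : ψ = fourierMultiplierCLM ℂ (fun _ : Space N => (1 : ℝ)) ψ)
  | succ k ih =>
    rw [Function.iterate_succ_apply', ih, h1, fourierMultiplierCLM_fourierMultiplierCLM_apply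
      (hasTemperateGrowth_one_add_sq_pow 1) (hasTemperateGrowth_one_add_sq_pow k)]
    congr 2
    ext x
    simp only [Pi.mul_apply]
    ring

/-- Fourier inversion bounds `|ψ|` by the `L¹` norm of `𝓕 ψ`. Writing `𝓕 ψ` as `(1 + ‖ξ‖²)^{-k}`
times `(1 + ‖ξ‖²)^k 𝓕 ψ`, Hölder and Plancherel conclude once `k` is so large that the first factor
is in `L²`. -/
lemma exists_norm_le_bessel_complex (N : ℕ) : ∃ (k : ℕ) (C : ℝ), 0 ≤ C ∧
    ∀ (ψ : 𝓢(Space N, ℂ)) (x : Space N),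
      ‖ψ x‖ ≤ C * ‖((bessel N ℂ)^[k] ψ).toLp 2 (volume : Measure (Space N))‖ := by
  obtain ⟨k, hk⟩ := Measure.HasTemperateGrowth.exists_eLpNorm_lt_top
    2
    (inferInstance : (volume : Measure (Space N)).HasTemperateGrowth)
  let a : Space N → ℝ := fun x => ((1 + ‖x‖ ^ 2) ^ k)⁻¹
  have ha : eLpNorm a 2 (volume : Measure (Space N)) < ⊤ := by
    refine lt_of_le_of_lt (eLpNorm_mono (g := fun x : Space N =>
      (2 : ℝ) ^ k • (1 + ‖x‖) ^ (-k : ℝ)) fun x => ?_) ?_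
    · simp only [a, smul_eq_mul]
      rw [Real.norm_of_nonneg (by positivity), Real.norm_of_nonneg (by positivity),
        Real.rpow_neg (by positivity), Real.rpow_natCast, ← div_eq_mul_inv, ← inv_div, ← div_pow]
      gcongr
      rw [div_le_iff₀ two_pos]
      nlinarith [sq_nonneg (‖x‖ - 1), norm_nonneg x]
    · have := eLpNorm_const_smul_le (c := (2 : ℝ) ^ k) (f := fun x : Space N =>
        (1 + ‖x‖) ^ (-k : ℝ)) (p := 2) (μ := (volume : Measure (Space N)))
      exact lt_of_le_of_lt this (ENNReal.mul_lt_top (by simp) hk)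
  refine ⟨k, (eLpNorm a 2 (volume : Measure (Space N))).toReal, ENNReal.toReal_nonneg,
    fun ψ x => ?_⟩
  have h1 : ‖ψ x‖ ≤ ‖(𝓕 ψ).toLp 1 (volume : Measure (Space N))‖ := by
    have h2 := norm_fourier_apply_le_toLp_one (𝓕 ψ) (-x)
    have h3 : 𝓕⁻ (𝓕 ψ) = ψ := FourierTransform.fourierInv_fourier_eq ψ
    have h5 : ψ x = 𝓕⁻ (𝓕 ψ) x := by rw [h3]
    rw [h5, fourierInv_apply_eq]
    simpa using h2
  refine h1.trans ?_
  rw [← norm_fourier_toL2_eq, norm_toLp, norm_toLp, ← ENNReal.toReal_mul, bessel_iterate_eq,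
    fourierMultiplierCLM_apply, FourierTransform.fourier_fourierInv_eq]
  refine ENNReal.toReal_mono (ENNReal.mul_ne_top ha.ne (eLpNorm_lt_top _ _ _).ne) ?_
  have h4 : ⇑(𝓕 ψ : 𝓢(Space N, ℂ)) = a • ⇑(smulLeftCLM ℂ (fun x : Space N => (1 + ‖x‖ ^ 2) ^ k) (𝓕 ψ)) := by
    ext y
    rw [Pi.smul_apply', smulLeftCLM_apply_apply (hasTemperateGrowth_one_add_sq_pow k), smul_smul]
    simp only [a]
    rw [inv_mul_cancel₀ (by positivity), one_smul]
  conv_lhs => rw [h4]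
  refine eLpNorm_smul_le_mul_eLpNorm (SchwartzMap.continuous _).aestronglyMeasurable ?_
  refine Continuous.aestronglyMeasurable ?_
  exact Continuous.inv₀ (by fun_prop) fun y => by positivity

lemma lineDerivOp_postcompCLM (L : 𝕜 →L[ℝ] ℂ) (m : Space N) (ψ : 𝓢(Space N, 𝕜)) :
    ∂_{m} (postcompCLM L ψ) = postcompCLM L (∂_{m} ψ) := by
  ext x
  rw [postcompCLM_apply, lineDerivOp_apply_eq_fderiv, lineDerivOp_apply_eq_fderiv]
  have : ⇑(postcompCLM L ψ) = L ∘ ψ := rfl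
  rw [this, (L.hasFDerivAt.comp x (ψ.hasFDerivAt x)).fderiv]
  rfl

/-- With `L` the norm-preserving map `𝕜 → ℂ`, this carries the complex estimate over to `𝕜`-valued
functions. -/
lemma bessel_iterate_postcompCLM (L : 𝕜 →L[ℝ] ℂ) (k : ℕ) (ψ : 𝓢(Space N, 𝕜)) :
    (bessel N ℂ)^[k] (postcompCLM L ψ) = postcompCLM L ((bessel N 𝕜)^[k] ψ) := by
  induction k with
  | zero => rfl
  | succ k ih =>
    rw [Function.iterate_succ_apply', Function.iterate_succ_apply', ih, bessel_apply, bessel_apply]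
    simp only [lineDerivOp_postcompCLM, map_sub, map_smul, map_sum]

/-- Sobolev embedding: the supremum norm is controlled by the `L²` norm of enough derivatives. -/
lemma exists_seminorm_le_bessel (N : ℕ) (𝕜 : Type*) [RCLike 𝕜] : ∃ (k : ℕ) (C : ℝ), 0 ≤ C ∧
    ∀ ψ : 𝓢(Space N, 𝕜), SchwartzMap.seminorm 𝕜 0 0 ψ ≤
      C * ‖((bessel N 𝕜)^[k] ψ).toLp 2 (volume : Measure (Space N))‖ := by
  obtain ⟨k, C, hC, h⟩ := exists_norm_le_bessel_complex N
  refine ⟨k, C, hC, fun ψ => seminorm_le_bound 𝕜 0 0 ψ (by positivity) fun x => ?_⟩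
  have h1 := h (postcompCLM (RCLike.map 𝕜 ℂ) ψ) x
  rw [postcompCLM_apply, norm_toComplex, bessel_iterate_postcompCLM] at h1
  rw [pow_zero, one_mul, norm_iteratedFDeriv_zero]
  refine h1.trans_eq ?_
  rw [norm_toLp, norm_toLp]
  congr 2
  refine eLpNorm_congr_norm_ae (Eventually.of_forall fun y => ?_)
  rw [postcompCLM_apply, norm_toComplex]

end SobolevEmbedding

/-! ### Ladder operators, Hermite spaces and the number operator -/

section LadderOperators

open SchwartzMap LineDeriv

/-- The square root `(p^N)^{1/2}` as a Schwartz function. -/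
lemma exists_schwartz_sqrt_density (N : ℕ) :
    ∃ h : 𝓢(Space N, ℝ), ∀ x, h x = Real.sqrt (density N x) := by
  obtain ⟨a, ha⟩ : ∃ a : ℝ, ∀ x : Space N,
      Real.sqrt (density N x) = Real.exp (-‖x‖ ^ 2 / 4 + a) := by
    refine ⟨Real.log ((2 * Real.pi) ^ (-(N : ℝ) / 2)) / 2, fun x => ?_⟩
    have hc : (0 : ℝ) < (2 * Real.pi) ^ (-(N : ℝ) / 2) := by positivity
    rw [density, ← Real.exp_log hc, ← Real.exp_add, Real.sqrt_eq_rpow, ← Real.exp_mul,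
      Real.log_exp]
    congr 1
    ring
  let f : Space N → ℝ := fun x => -‖x‖ ^ 2 / 4 + a
  have hf : f.HasTemperateGrowth := by
    have h1 : f = (fun x => (-1 / 4 : ℝ) * ‖x‖ ^ 2) + fun _ => a := by
      ext x; simp only [f, Pi.add_apply]; ring
    rw [h1]
    exact ((Function.HasTemperateGrowth.const (-1 / 4 : ℝ)).mul
      (Function.hasTemperateGrowth_norm_sq (Space N))).add (Function.HasTemperateGrowth.const a)
  refine ⟨⟨fun x => Real.sqrt (density N x), contDiff_sqrt_density N, fun m n => ?_⟩, fun x => rfl⟩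
  obtain ⟨k, C, hC, hb⟩ := hf.norm_iteratedFDeriv_le_uniform n
  have hfun : (fun x => Real.sqrt (density N x)) = Real.exp ∘ f := by
    ext x; exact ha x
  rw [hfun]
  -- The Faà di Bruno bound leaves a power of `1 + ‖x‖`, at most a factorial times `exp (1 + ‖x‖)`.
  -- The constant `2 + a` is the maximum of `1 + ‖x‖ - ‖x‖²/4 + a`, attained at `‖x‖ = 2`.
  refine ⟨n.factorial * (1 + C) ^ n * ((m + k * n).factorial * Real.exp (2 + a)), fun x => ?_⟩
  have hx : (1 : ℝ) ≤ 1 + ‖x‖ := by linarith [norm_nonneg x]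
  have h1 := norm_iteratedFDeriv_comp_le (𝕜 := ℝ) (N := ∞) (n := n) (g := Real.exp) (f := f)
    Real.contDiff_exp hf.1 (by exact_mod_cast le_top) x (C := Real.exp (f x))
    (D := (1 + C) * (1 + ‖x‖) ^ k)
    (fun i _ => by
      rw [norm_iteratedFDeriv_eq_norm_iteratedDeriv, iteratedDeriv_eq_iterate,
        Real.iter_deriv_exp, Real.norm_of_nonneg (Real.exp_pos _).le])
    (fun i hi1 hi => by
      refine (hb i hi x).trans ?_
      have h2 : (1 : ℝ) ≤ (1 + C) * (1 + ‖x‖) ^ k :=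
        one_le_mul_of_one_le_of_one_le (by linarith) (one_le_pow₀ hx)
      calc C * (1 + ‖x‖) ^ k ≤ (1 + C) * (1 + ‖x‖) ^ k := by gcongr; linarith
        _ ≤ _ := le_self_pow₀ h2 (by omega))
  have h3 := Real.pow_div_factorial_le_exp (1 + ‖x‖) (by positivity) (m + k * n)
  rw [div_le_iff₀ (by positivity)] at h3
  calc ‖x‖ ^ m * ‖iteratedFDeriv ℝ n (Real.exp ∘ f) x‖
      ≤ (1 + ‖x‖) ^ m *
        (n.factorial * Real.exp (f x) * ((1 + C) * (1 + ‖x‖) ^ k) ^ n) := by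
        gcongr; linarith
    _ = n.factorial * (1 + C) ^ n * ((1 + ‖x‖) ^ (m + k * n) * Real.exp (f x)) := by
        rw [mul_pow, ← pow_mul]; ring
    _ ≤ n.factorial * (1 + C) ^ n *
        (Real.exp (1 + ‖x‖) * (m + k * n).factorial * Real.exp (f x)) := by gcongr
    _ = n.factorial * (1 + C) ^ n *
        ((m + k * n).factorial * Real.exp (1 + ‖x‖ + f x)) := by
        rw [Real.exp_add (1 + ‖x‖)]; ring
    _ ≤ _ := by
        have h4 : 1 + ‖x‖ + f x ≤ 2 + a := by
          simp only [f]
          nlinarith [sq_nonneg (‖x‖ - 2)]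
        have := Real.exp_le_exp.2 h4
        gcongr

/-- The ground state `(p^N)^{1/2}`. -/
def ground (N : ℕ) (𝕜 : Type*) [RCLike 𝕜] : 𝓢(Space N, 𝕜) :=
  postcompCLM (RCLike.ofRealCLM (K := 𝕜)) (exists_schwartz_sqrt_density N).choose

variable {N : ℕ} {𝕜 : Type*} [RCLike 𝕜]

lemma ground_apply (x : Space N) : ground N 𝕜 x = ((Real.sqrt (density N x) : ℝ) : 𝕜) := by
  rw [ground, postcompCLM_apply, (exists_schwartz_sqrt_density N).choose_spec]
  rfl

lemma hasTemperateGrowth_coord (i : Fin N) :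
    (fun x : Space N => ((x i : ℝ) : 𝕜)).HasTemperateGrowth :=
  ((RCLike.ofRealCLM (K := 𝕜)).comp
    (EuclideanSpace.proj i : Space N →L[ℝ] ℝ)).hasTemperateGrowth

/-- Multiplication by `x_i`. -/
def mulCoord (i : Fin N) : 𝓢(Space N, 𝕜) →L[𝕜] 𝓢(Space N, 𝕜) :=
  smulLeftCLM 𝕜 fun x : Space N => ((x i : ℝ) : 𝕜)

/-- The derivative `∂/∂x_i`. -/
def derivCoord (i : Fin N) : 𝓢(Space N, 𝕜) →L[𝕜] 𝓢(Space N, 𝕜) :=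
  lineDerivOpCLM 𝕜 𝓢(Space N, 𝕜) (EuclideanSpace.single i (1 : ℝ) : Space N)

lemma mulCoord_apply (i : Fin N) (ψ : 𝓢(Space N, 𝕜)) (x : Space N) :
    mulCoord i ψ x = (x i : 𝕜) * ψ x :=
  smulLeftCLM_apply_apply (hasTemperateGrowth_coord i) ψ x

lemma derivCoord_apply (i : Fin N) (ψ : 𝓢(Space N, 𝕜)) (x : Space N) :
    derivCoord i ψ x = fderiv ℝ ψ x (EuclideanSpace.single i 1) := rfl

lemma derivCoord_eq (i : Fin N) (ψ : 𝓢(Space N, 𝕜)) :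
    derivCoord i ψ = ∂_{(EuclideanSpace.single i (1 : ℝ) : Space N)} ψ := rfl

lemma mulCoord_comm (i j : Fin N) (ψ : 𝓢(Space N, 𝕜)) :
    mulCoord i (mulCoord j ψ) = mulCoord j (mulCoord i ψ) := by
  ext x
  simp only [mulCoord_apply]
  ring

lemma derivCoord_comm (i j : Fin N) (ψ : 𝓢(Space N, 𝕜)) :
    derivCoord i (derivCoord j ψ) = derivCoord j (derivCoord i ψ) := by
  ext x
  have h1 : ∀ v w : Space N, fderiv ℝ (fun y => fderiv ℝ ψ y v) x w =
      fderiv ℝ (fun y => fderiv ℝ ψ y) x w v := by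
    intro v w
    have h2 : HasFDerivAt (fun y => fderiv ℝ ψ y) (fderiv ℝ (fun y => fderiv ℝ ψ y) x) x :=
      (fderivCLM ℝ (Space N) 𝕜 ψ).hasFDerivAt x
    rw [(h2.clm_apply (hasFDerivAt_const v x)).fderiv]
    simp
  have h3 := second_derivative_symmetric (𝕜 := ℝ) (fun y => ψ.hasFDerivAt y)
    ((fderivCLM ℝ (Space N) 𝕜 ψ).hasFDerivAt x) (EuclideanSpace.single i (1 : ℝ) : Space N)
    (EuclideanSpace.single j (1 : ℝ) : Space N)
  calc _ = _ := h1 _ _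
    _ = _ := h3
    _ = _ := (h1 _ _).symm

lemma derivCoord_mulCoord (i j : Fin N) (ψ : 𝓢(Space N, 𝕜)) :
    derivCoord i (mulCoord j ψ) = mulCoord j (derivCoord i ψ) + if i = j then ψ else 0 := by
  ext x
  let p : Space N →L[ℝ] 𝕜 := (RCLike.ofRealCLM (K := 𝕜)).comp
    (EuclideanSpace.proj j : Space N →L[ℝ] ℝ)
  have h1 : ⇑(mulCoord j ψ) = ⇑p * ⇑ψ := by
    ext y; exact mulCoord_apply j ψ y
  rw [derivCoord_apply, h1, (p.hasFDerivAt.mul (ψ.hasFDerivAt x)).fderiv]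
  have h2 : p (EuclideanSpace.single i 1) = if i = j then 1 else 0 := by
    simp [p, eq_comm]
  simp only [add_apply, mulCoord_apply, derivCoord_apply, smul_apply, smul_eq_mul, h2]
  split_ifs
  · simp [p]
  · simp [p]

/-- The annihilation operator `∂/∂x_i + x_i/2`. -/
def annih (i : Fin N) : 𝓢(Space N, 𝕜) →L[𝕜] 𝓢(Space N, 𝕜) :=
  derivCoord i + (2⁻¹ : 𝕜) • mulCoord i

/-- The creation operator `-∂/∂x_i + x_i/2`. -/
def creat (i : Fin N) : 𝓢(Space N, 𝕜) →L[𝕜] 𝓢(Space N, 𝕜) :=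
  -derivCoord i + (2⁻¹ : 𝕜) • mulCoord i

lemma annih_apply (i : Fin N) (ψ : 𝓢(Space N, 𝕜)) :
    annih i ψ = derivCoord i ψ + (2⁻¹ : 𝕜) • mulCoord i ψ := rfl

lemma creat_apply (i : Fin N) (ψ : 𝓢(Space N, 𝕜)) :
    creat i ψ = -derivCoord i ψ + (2⁻¹ : 𝕜) • mulCoord i ψ := rfl

lemma mulCoord_eq (i : Fin N) (ψ : 𝓢(Space N, 𝕜)) : mulCoord i ψ = annih i ψ + creat i ψ := by
  rw [annih_apply, creat_apply, add_add_add_comm, add_neg_cancel, zero_add, ← add_smul,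
    ← two_mul, mul_inv_cancel₀ two_ne_zero, one_smul]

lemma derivCoord_eq_ladder (i : Fin N) (ψ : 𝓢(Space N, 𝕜)) :
    derivCoord i ψ = (2⁻¹ : 𝕜) • annih i ψ - (2⁻¹ : 𝕜) • creat i ψ := by
  rw [← smul_sub, annih_apply, creat_apply, add_sub_add_right_eq_sub, sub_neg_eq_add,
    ← two_smul 𝕜, smul_smul, inv_mul_cancel₀ two_ne_zero, one_smul]

lemma creat_comm (i j : Fin N) (ψ : 𝓢(Space N, 𝕜)) :
    creat i (creat j ψ) = creat j (creat i ψ) := by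
  simp only [creat_apply, map_add, map_neg, map_smul, derivCoord_mulCoord, derivCoord_comm i j,
    mulCoord_comm i j, eq_comm (a := i)]
  module

/-- The canonical commutation relation. The factors `1/2` in the ladder operators normalize the
commutator to `δ_ij`. -/
lemma annih_creat (i j : Fin N) (ψ : 𝓢(Space N, 𝕜)) :
    annih i (creat j ψ) = creat j (annih i ψ) + if i = j then ψ else 0 := by
  simp only [creat_apply, annih_apply, map_add, map_neg, map_smul, derivCoord_mulCoord,
    derivCoord_comm i j, mulCoord_comm i j, eq_comm (a := i)]
  module

/-- Since `∂_i (p^N)^{1/2} = -(x_i/2)(p^N)^{1/2}`, the term `x_i/2` cancels: annihilation is `∂_i`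
conjugated by `(p^N)^{1/2}`. -/
lemma annih_sqrt_density_mul (i : Fin N) (ψ : 𝓢(Space N, 𝕜)) (φ : Space N → 𝕜) (x : Space N)
    (hφ : DifferentiableAt ℝ φ x) (h : ∀ y, ψ y = (Real.sqrt (density N y) : 𝕜) * φ y) :
    annih i ψ x = (Real.sqrt (density N x) : 𝕜) * fderiv ℝ φ x (EuclideanSpace.single i 1) := by
  have h1 : HasFDerivAt (density N) (density N x • (-innerSL ℝ x)) x := by
    have h2 : HasFDerivAt (fun y : Space N => -‖y‖ ^ 2 / 2) (-innerSL ℝ x) x := by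
      have := ((hasStrictFDerivAt_norm_sq x).hasFDerivAt.const_mul (-1 / 2 : ℝ))
      refine (this.congr_fderiv ?_).congr_of_eventuallyEq (Eventually.of_forall fun y => by
        simp only; ring)
      ext y
      simp
      ring
    have h3 := h2.exp.const_mul ((2 * Real.pi) ^ (-(N : ℝ) / 2))
    exact h3.congr_fderiv (by rw [smul_smul]; rfl)
  have hp := density_pos N x
  have h4 := h1.sqrt hp.ne'
  have h5 : HasFDerivAt (fun y => ((Real.sqrt (density N y) : ℝ) : 𝕜))
      ((RCLike.ofRealCLM (K := 𝕜)).comp _) x :=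
    (RCLike.ofRealCLM (K := 𝕜)).hasFDerivAt.comp x h4
  have h6 : ⇑ψ = (fun y => (Real.sqrt (density N y) : 𝕜)) * φ := funext h
  rw [annih_apply, add_apply, smul_apply, derivCoord_apply, mulCoord_apply, h6,
    (h5.mul hφ.hasFDerivAt).fderiv]
  have hs : Real.sqrt (density N x) ≠ 0 := (Real.sqrt_pos.2 hp).ne'
  have h7 : (1 / (2 * Real.sqrt (density N x)) * density N x : ℝ) =
      Real.sqrt (density N x) / 2 := by
    nth_rewrite 2 [← Real.mul_self_sqrt hp.le]
    field_simp
  have h8 : inner ℝ x (EuclideanSpace.single i (1 : ℝ)) = x i := by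
    rw [EuclideanSpace.inner_single_right]; simp
  simp only [add_apply, smul_apply, Pi.mul_apply, ContinuousLinearMap.comp_apply, neg_apply, innerSL_apply_apply, smul_eq_mul,
    RCLike.ofRealCLM_apply, h8, ← mul_assoc, h7]
  push_cast
  ring

lemma annih_ground (i : Fin N) : annih i (ground N 𝕜) = 0 := by
  ext x
  rw [annih_sqrt_density_mul i (ground N 𝕜) (fun _ => 1) x (differentiableAt_const _)
    fun y => by rw [ground_apply, mul_one]]
  simp

/-- The `n`-particle space, spanned by the Hermite functions of degree `n`. -/
def hermiteSpace (N : ℕ) (𝕜 : Type*) [RCLike 𝕜] : ℕ → Submodule 𝕜 𝓢(Space N, 𝕜)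
  | 0 => Submodule.span 𝕜 {ground N 𝕜}
  | n + 1 => ⨆ i : Fin N, (hermiteSpace N 𝕜 n).map (creat i).toLinearMap

instance finiteDimensional_hermiteSpace (n : ℕ) :
    FiniteDimensional 𝕜 (hermiteSpace N 𝕜 n) := by
  induction n with
  | zero => exact inferInstanceAs (FiniteDimensional 𝕜 (Submodule.span 𝕜 {ground N 𝕜}))
  | succ n ih =>
    exact inferInstanceAs (FiniteDimensional 𝕜
      ↥(⨆ i : Fin N, (hermiteSpace N 𝕜 n).map (creat i).toLinearMap))

lemma ground_mem : ground N 𝕜 ∈ hermiteSpace N 𝕜 0 := Submodule.mem_span_singleton_self _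

lemma creat_mem (i : Fin N) {n : ℕ} {w : 𝓢(Space N, 𝕜)} (hw : w ∈ hermiteSpace N 𝕜 n) :
    creat i w ∈ hermiteSpace N 𝕜 (n + 1) :=
  Submodule.mem_iSup_of_mem (p := fun i : Fin N =>
    (hermiteSpace N 𝕜 n).map (creat i).toLinearMap) i (Submodule.mem_map_of_mem hw)

lemma hermiteSpace_succ_induction {n : ℕ} {p : 𝓢(Space N, 𝕜) → Prop}
    (hcreat : ∀ i, ∀ w ∈ hermiteSpace N 𝕜 n, p (creat i w)) (hzero : p 0)
    (hadd : ∀ v w, p v → p w → p (v + w)) {w : 𝓢(Space N, 𝕜)}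
    (hw : w ∈ hermiteSpace N 𝕜 (n + 1)) : p w := by
  refine Submodule.iSup_induction (fun i : Fin N =>
    (hermiteSpace N 𝕜 n).map (creat i).toLinearMap) (motive := p) hw ?_ hzero hadd
  rintro i _ ⟨v, hv, rfl⟩
  exact hcreat i v hv

lemma annih_eq_zero (i : Fin N) {w : 𝓢(Space N, 𝕜)} (hw : w ∈ hermiteSpace N 𝕜 0) :
    annih i w = 0 := by
  obtain ⟨c, rfl⟩ := Submodule.mem_span_singleton.1 hw
  rw [map_smul, annih_ground, smul_zero]

/-- Commuting `annih i` past the outermost creation operator leaves either an element of the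
previous space or a term to which induction applies. -/
lemma annih_mem (i : Fin N) {n : ℕ} {w : 𝓢(Space N, 𝕜)} (hw : w ∈ hermiteSpace N 𝕜 (n + 1)) :
    annih i w ∈ hermiteSpace N 𝕜 n := by
  induction n generalizing w with
  | zero =>
    refine hermiteSpace_succ_induction (p := fun w => annih i w ∈ hermiteSpace N 𝕜 0)
      (fun j v hv => ?_) (by simp) (fun v w hv hw => by rw [map_add]; exact add_mem hv hw) hw
    rw [annih_creat, annih_eq_zero i hv, map_zero, zero_add]
    split_ifs
    exacts [hv, zero_mem _]
  | succ n ih =>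
    refine hermiteSpace_succ_induction (p := fun w => annih i w ∈ hermiteSpace N 𝕜 (n + 1))
      (fun j v hv => ?_) (by simp) (fun v w hv hw => by rw [map_add]; exact add_mem hv hw) hw
    rw [annih_creat]
    refine add_mem (creat_mem j (ih hv)) ?_
    split_ifs
    exacts [hv, zero_mem _]

/-- The number operator `∑ (-∂/∂x_i + x_i/2)(∂/∂x_i + x_i/2)`, which is `L` conjugated by
`(p^N)^{1/2}`. -/
def number (N : ℕ) (𝕜 : Type*) [RCLike 𝕜] : 𝓢(Space N, 𝕜) →L[𝕜] 𝓢(Space N, 𝕜) :=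
  ∑ i, (creat i) ∘L (annih i)

lemma number_apply (ψ : 𝓢(Space N, 𝕜)) : number N 𝕜 ψ = ∑ i, creat i (annih i ψ) := by
  simp [number]

lemma number_creat (j : Fin N) (ψ : 𝓢(Space N, 𝕜)) :
    number N 𝕜 (creat j ψ) = creat j (number N 𝕜 ψ) + creat j ψ := by
  simp only [number_apply, annih_creat, map_add, Finset.sum_add_distrib, map_sum, creat_comm j]
  congr 1
  rw [Finset.sum_eq_single j] <;> simp +contextual

/-- By `number_creat`, each creation operator raises the eigenvalue by one, starting from `0` on the
ground state. -/
lemma number_eq {n : ℕ} {w : 𝓢(Space N, 𝕜)} (hw : w ∈ hermiteSpace N 𝕜 n) :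
    number N 𝕜 w = (n : 𝕜) • w := by
  induction n generalizing w with
  | zero => simp [number_apply, annih_eq_zero _ hw]
  | succ n ih =>
    refine hermiteSpace_succ_induction (p := fun w => number N 𝕜 w = ((n + 1 : ℕ) : 𝕜) • w)
      (fun j v hv => ?_) (by simp) (fun v w hv hw => by rw [map_add, hv, hw, smul_add]) hw
    rw [number_creat, ih hv, map_smul]
    push_cast
    rw [add_smul, one_smul]

end LadderOperators

/-! ### Polynomial growth of Schwartz seminorms on the Hermite spaces -/

section PolynomialBounds

open SchwartzMap LineDeriv
open scoped InnerProductSpace ComplexConjugate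

/-- `L²(dx)`. -/
abbrev FlatL2 (N : ℕ) (𝕜 : Type*) [RCLike 𝕜] : Type _ := Lp 𝕜 2 (volume : Measure (Space N))

/-- The embedding of the Schwartz space into `L²(dx)`. -/
def embL2 (N : ℕ) (𝕜 : Type*) [RCLike 𝕜] : 𝓢(Space N, 𝕜) →L[𝕜] FlatL2 N 𝕜 :=
  toLpCLM 𝕜 𝕜 2 (volume : Measure (Space N))

variable {N : ℕ} {𝕜 : Type*} [RCLike 𝕜]

lemma coeFn_embL2 (ψ : 𝓢(Space N, 𝕜)) : embL2 N 𝕜 ψ =ᵐ[volume] ψ := ψ.coeFn_toLp 2 volume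

lemma embL2_injective : Function.Injective (embL2 N 𝕜) := injective_toLp 2 volume

lemma inner_embL2 (ψ : 𝓢(Space N, 𝕜)) (u : FlatL2 N 𝕜) :
    ⟪embL2 N 𝕜 ψ, u⟫_𝕜 = ∫ x, conj (ψ x) * u x := by
  rw [L2.inner_def]
  refine integral_congr_ae ?_
  filter_upwards [coeFn_embL2 ψ] with x hx
  rw [hx, RCLike.inner_apply, mul_comm]

lemma inner_embL2_embL2 (φ ψ : 𝓢(Space N, 𝕜)) :
    ⟪embL2 N 𝕜 φ, embL2 N 𝕜 ψ⟫_𝕜 = ∫ x, conj (φ x) * ψ x := by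
  rw [inner_embL2]
  refine integral_congr_ae ?_
  filter_upwards [coeFn_embL2 ψ] with x hx
  rw [hx]

lemma inner_derivCoord (i : Fin N) (φ ψ : 𝓢(Space N, 𝕜)) :
    ⟪embL2 N 𝕜 (derivCoord i φ), embL2 N 𝕜 ψ⟫_𝕜 =
      -⟪embL2 N 𝕜 φ, embL2 N 𝕜 (derivCoord i ψ)⟫_𝕜 := by
  rw [inner_embL2_embL2, inner_embL2_embL2]
  have := integral_bilinear_lineDerivOp_right_eq_neg_left (μ := (volume : Measure (Space N))) φ ψ
    ((ContinuousLinearMap.mul ℝ 𝕜).comp (RCLike.conjCLE (K := 𝕜)).toContinuousLinearMap)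
    (EuclideanSpace.single i (1 : ℝ))
  simp only [ContinuousLinearMap.comp_apply, ContinuousLinearMap.mul_apply',
    ContinuousLinearEquiv.coe_coe, RCLike.conjCLE_apply] at this
  simp only [derivCoord_eq]
  rw [this, neg_neg]

lemma inner_mulCoord (i : Fin N) (φ ψ : 𝓢(Space N, 𝕜)) :
    ⟪embL2 N 𝕜 (mulCoord i φ), embL2 N 𝕜 ψ⟫_𝕜 =
      ⟪embL2 N 𝕜 φ, embL2 N 𝕜 (mulCoord i ψ)⟫_𝕜 := by
  rw [inner_embL2_embL2, inner_embL2_embL2]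
  congr 1
  ext x
  simp only [mulCoord_apply, map_mul, RCLike.conj_ofReal]
  ring

lemma inner_annih (i : Fin N) (φ ψ : 𝓢(Space N, 𝕜)) :
    ⟪embL2 N 𝕜 (annih i φ), embL2 N 𝕜 ψ⟫_𝕜 =
      ⟪embL2 N 𝕜 φ, embL2 N 𝕜 (creat i ψ)⟫_𝕜 := by
  simp only [annih_apply, creat_apply, map_add, map_smul, map_neg, inner_add_left, inner_add_right,
    inner_smul_left, inner_smul_right, inner_neg_right, inner_derivCoord, inner_mulCoord, map_inv₀,
    map_ofNat]

lemma inner_creat (i : Fin N) (φ ψ : 𝓢(Space N, 𝕜)) :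
    ⟪embL2 N 𝕜 (creat i φ), embL2 N 𝕜 ψ⟫_𝕜 =
      ⟪embL2 N 𝕜 φ, embL2 N 𝕜 (annih i ψ)⟫_𝕜 := by
  rw [← inner_conj_symm, ← inner_annih, inner_conj_symm]

lemma inner_number (φ ψ : 𝓢(Space N, 𝕜)) :
    ⟪embL2 N 𝕜 (number N 𝕜 φ), embL2 N 𝕜 ψ⟫_𝕜 =
      ⟪embL2 N 𝕜 φ, embL2 N 𝕜 (number N 𝕜 ψ)⟫_𝕜 := by
  simp only [number_apply, map_sum, sum_inner, inner_sum, inner_creat, inner_annih]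

/-- Summing over all directions, `∑ ‖a_j w‖² = ⟨w, H w⟩ = n ‖w‖²`; one term is at most the sum. -/
lemma norm_annih_le (i : Fin N) {n : ℕ} {w : 𝓢(Space N, 𝕜)} (hw : w ∈ hermiteSpace N 𝕜 n) :
    ‖embL2 N 𝕜 (annih i w)‖ ^ 2 ≤ n * ‖embL2 N 𝕜 w‖ ^ 2 := by
  have h1 : ∑ j, ‖embL2 N 𝕜 (annih j w)‖ ^ 2 = n * ‖embL2 N 𝕜 w‖ ^ 2 := by
    apply RCLike.ofReal_injective (K := 𝕜)
    push_cast
    simp only [← inner_self_eq_norm_sq_to_K (𝕜 := 𝕜), inner_annih]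
    rw [← inner_sum, ← map_sum, ← number_apply, number_eq hw, map_smul, inner_smul_right]
  rw [← h1]
  exact Finset.single_le_sum (f := fun j => ‖embL2 N 𝕜 (annih j w)‖ ^ 2)
    (fun j _ => by positivity) (Finset.mem_univ i)

/-- The commutation relation gives `‖a_i* w‖² = ‖a_i w‖² + ‖w‖²`. -/
lemma norm_creat_le (i : Fin N) {n : ℕ} {w : 𝓢(Space N, 𝕜)} (hw : w ∈ hermiteSpace N 𝕜 n) :
    ‖embL2 N 𝕜 (creat i w)‖ ^ 2 ≤ (n + 1) * ‖embL2 N 𝕜 w‖ ^ 2 := by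
  have h1 : ‖embL2 N 𝕜 (creat i w)‖ ^ 2 = ‖embL2 N 𝕜 (annih i w)‖ ^ 2 + ‖embL2 N 𝕜 w‖ ^ 2 := by
    apply RCLike.ofReal_injective (K := 𝕜)
    push_cast
    simp only [← inner_self_eq_norm_sq_to_K (𝕜 := 𝕜)]
    rw [inner_creat, annih_creat, if_pos rfl, map_add, inner_add_right, inner_annih]
  rw [h1, add_one_mul]
  have := norm_annih_le i hw
  linarith

/-- A seminorm on the Schwartz space that grows at most polynomially, relative to the `L²` norm,
on the Hermite spaces. -/
def PolyBounded (q : Seminorm 𝕜 𝓢(Space N, 𝕜)) : Prop :=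
  ∃ (C : ℝ) (M : ℕ), 0 ≤ C ∧ ∀ n, ∀ w ∈ hermiteSpace N 𝕜 n,
    q w ≤ C * (1 + n) ^ M * ‖embL2 N 𝕜 w‖

lemma PolyBounded.mono {p q : Seminorm 𝕜 𝓢(Space N, 𝕜)} (hq : PolyBounded q)
    (h : ∀ w, p w ≤ q w) : PolyBounded p := by
  obtain ⟨C, M, hC, hb⟩ := hq
  exact ⟨C, M, hC, fun n w hw => (h w).trans (hb n w hw)⟩

lemma PolyBounded.add {p q : Seminorm 𝕜 𝓢(Space N, 𝕜)} (hp : PolyBounded p)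
    (hq : PolyBounded q) : PolyBounded (p + q) := by
  obtain ⟨C, M, hC, hb⟩ := hp
  obtain ⟨C', M', hC', hb'⟩ := hq
  refine ⟨C + C', M + M', by positivity, fun n w hw => ?_⟩
  have h1 : (1 : ℝ) ≤ 1 + n := by linarith [(Nat.cast_nonneg n : (0 : ℝ) ≤ n)]
  have h2 : (1 + n : ℝ) ^ M ≤ (1 + n) ^ (M + M') := pow_le_pow_right₀ h1 (by omega)
  have h3 : (1 + n : ℝ) ^ M' ≤ (1 + n) ^ (M + M') := pow_le_pow_right₀ h1 (by omega)
  calc p w + q w ≤ C * (1 + n) ^ M * ‖embL2 N 𝕜 w‖ + C' * (1 + n) ^ M' * ‖embL2 N 𝕜 w‖ :=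
        add_le_add (hb n w hw) (hb' n w hw)
    _ ≤ C * (1 + n) ^ (M + M') * ‖embL2 N 𝕜 w‖ + C' * (1 + n) ^ (M + M') * ‖embL2 N 𝕜 w‖ := by
        gcongr
    _ = _ := by ring

lemma PolyBounded.zero : PolyBounded (0 : Seminorm 𝕜 𝓢(Space N, 𝕜)) :=
  ⟨0, 0, le_rfl, fun n w _ => by simp⟩

lemma PolyBounded.sum {ι : Type*} {s : Finset ι} {q : ι → Seminorm 𝕜 𝓢(Space N, 𝕜)}
    (hq : ∀ i ∈ s, PolyBounded (q i)) : PolyBounded (∑ i ∈ s, q i) :=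
  Finset.sum_induction q PolyBounded (fun _ _ => PolyBounded.add) PolyBounded.zero hq

lemma PolyBounded.comp_annih {q : Seminorm 𝕜 𝓢(Space N, 𝕜)} (hq : PolyBounded q) (i : Fin N) :
    PolyBounded (q.comp (annih i).toLinearMap) := by
  obtain ⟨C, M, hC, hb⟩ := hq
  refine ⟨C, M + 1, hC, fun n w hw => ?_⟩
  change q (annih i w) ≤ _
  rcases n with _ | n
  · rw [annih_eq_zero i hw, map_zero]
    positivity
  · have h1 := hb n _ (annih_mem i hw)
    have h2 := norm_annih_le i hw
    have h3 : ‖embL2 N 𝕜 (annih i w)‖ ≤ (1 + (n + 1 : ℕ)) * ‖embL2 N 𝕜 w‖ := by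
      refine abs_le_of_sq_le_sq' ?_ (by positivity) |>.2
      push_cast at h2 ⊢
      nlinarith [sq_nonneg ‖embL2 N 𝕜 w‖, (Nat.cast_nonneg n : (0 : ℝ) ≤ n),
        mul_nonneg (Nat.cast_nonneg n : (0 : ℝ) ≤ n) (sq_nonneg ‖embL2 N 𝕜 w‖),
        mul_nonneg (sq_nonneg (n : ℝ)) (sq_nonneg ‖embL2 N 𝕜 w‖)]
    calc q (annih i w) ≤ C * (1 + n) ^ M * ‖embL2 N 𝕜 (annih i w)‖ := h1
      _ ≤ C * (1 + (n + 1 : ℕ)) ^ M * ((1 + (n + 1 : ℕ)) * ‖embL2 N 𝕜 w‖) := by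
          gcongr
          simp
      _ = _ := by ring

lemma PolyBounded.comp_creat {q : Seminorm 𝕜 𝓢(Space N, 𝕜)} (hq : PolyBounded q) (i : Fin N) :
    PolyBounded (q.comp (creat i).toLinearMap) := by
  obtain ⟨C, M, hC, hb⟩ := hq
  refine ⟨C * 2 ^ M, M + 1, by positivity, fun n w hw => ?_⟩
  change q (creat i w) ≤ _
  have h1 := hb (n + 1) _ (creat_mem i hw)
  have h2 := norm_creat_le i hw
  have h3 : ‖embL2 N 𝕜 (creat i w)‖ ≤ (1 + n) * ‖embL2 N 𝕜 w‖ := by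
    refine abs_le_of_sq_le_sq' ?_ (by positivity) |>.2
    nlinarith [mul_nonneg (Nat.cast_nonneg n : (0 : ℝ) ≤ n) (sq_nonneg ‖embL2 N 𝕜 w‖),
      mul_nonneg (sq_nonneg (n : ℝ)) (sq_nonneg ‖embL2 N 𝕜 w‖)]
  calc q (creat i w) ≤ C * (1 + (n + 1 : ℕ)) ^ M * ‖embL2 N 𝕜 (creat i w)‖ := h1
    _ ≤ C * (2 * (1 + n)) ^ M * ((1 + n) * ‖embL2 N 𝕜 w‖) := by
        gcongr
        push_cast
        linarith [(Nat.cast_nonneg n : (0 : ℝ) ≤ n)]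
    _ = _ := by rw [mul_pow]; ring

/-- The operators on the Schwartz space under which polynomial boundedness is stable. -/
def tame (N : ℕ) (𝕜 : Type*) [RCLike 𝕜] : Subalgebra 𝕜 (𝓢(Space N, 𝕜) →L[𝕜] 𝓢(Space N, 𝕜)) where
  carrier := {T | ∀ q, PolyBounded q → PolyBounded (q.comp T.toLinearMap)}
  mul_mem' {S T} hS hT q hq := (hT _ (hS q hq)).mono fun _ => le_rfl
  add_mem' {S T} hS hT q hq := ((hS q hq).add (hT q hq)).mono fun w => map_add_le_add q _ _
  algebraMap_mem' c q hq := by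
    obtain ⟨C, M, hC, hb⟩ := hq
    refine ⟨‖c‖ * C, M, by positivity, fun n w hw => ?_⟩
    have h1 : (q.comp (algebraMap 𝕜 (𝓢(Space N, 𝕜) →L[𝕜] 𝓢(Space N, 𝕜)) c).toLinearMap) w =
        ‖c‖ * q w := map_smul_eq_mul q c w
    rw [h1, mul_assoc, mul_assoc, ← mul_assoc C]
    exact mul_le_mul_of_nonneg_left (hb n w hw) (norm_nonneg c)

lemma mulCoord_mem_tame (i : Fin N) : mulCoord i ∈ tame N 𝕜 := by
  have h : (mulCoord i : 𝓢(Space N, 𝕜) →L[𝕜] 𝓢(Space N, 𝕜)) = annih i + creat i := by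
    ext1 ψ; exact mulCoord_eq i ψ
  rw [h]
  exact add_mem (fun q hq => hq.comp_annih i) (fun q hq => hq.comp_creat i)

lemma derivCoord_mem_tame (i : Fin N) : derivCoord i ∈ tame N 𝕜 := by
  have h : (derivCoord i : 𝓢(Space N, 𝕜) →L[𝕜] 𝓢(Space N, 𝕜)) =
      (2⁻¹ : 𝕜) • annih i - (2⁻¹ : 𝕜) • creat i := by
    ext1 ψ; exact derivCoord_eq_ladder i ψ
  rw [h]
  exact sub_mem (Subalgebra.smul_mem _ (fun q hq => hq.comp_annih i) _)
    (Subalgebra.smul_mem _ (fun q hq => hq.comp_creat i) _)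

lemma exists_tame_iteratedLineDerivOp {n : ℕ} (I : Fin n → Fin N) : ∃ T ∈ tame N 𝕜,
    ∀ ψ : 𝓢(Space N, 𝕜), ∂^{fun j => (EuclideanSpace.single (I j) (1 : ℝ) : Space N)} ψ = T ψ := by
  induction n with
  | zero => exact ⟨1, one_mem _, fun ψ => by simp⟩
  | succ n ih =>
    obtain ⟨T, hT, h⟩ := ih (Fin.tail I)
    refine ⟨derivCoord (I 0) * T, mul_mem (derivCoord_mem_tame _) hT, fun ψ => ?_⟩
    rw [iteratedLineDerivOp_succ_left]
    exact congrArg _ (h ψ)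

lemma exists_tame_norm_sq_pow (k : ℕ) : ∃ T ∈ tame N 𝕜,
    ∀ ψ : 𝓢(Space N, 𝕜), smulLeftCLM 𝕜 (fun x : Space N => (‖x‖ ^ 2) ^ k) ψ = T ψ := by
  refine ⟨(∑ i, mulCoord i * mulCoord i) ^ k, pow_mem (sum_mem fun i _ =>
    mul_mem (mulCoord_mem_tame i) (mulCoord_mem_tame i)) k, fun ψ => ?_⟩
  have hg : ∀ k : ℕ, (fun x : Space N => (‖x‖ ^ 2) ^ k).HasTemperateGrowth := fun k =>
    (Function.hasTemperateGrowth_norm_sq (Space N)).pow k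
  ext x
  rw [smulLeftCLM_apply_apply (hg k)]
  induction k with
  | zero => simp
  | succ k ih =>
    rw [pow_succ' (‖x‖ ^ 2) k, pow_succ' _ k, mul_smul, ih, mul_apply_eq_comp, EuclideanSpace.norm_sq_eq]
    simp [mulCoord_apply, Finset.sum_mul, RCLike.real_smul_eq_coe_mul,
      ← mul_assoc, ← sq]

lemma bessel_mem_tame : bessel N 𝕜 ∈ tame N 𝕜 := by
  have h : bessel N 𝕜 = 1 - (((((2 * Real.pi) ^ 2)⁻¹ : ℝ)) : 𝕜) •
      ∑ i, derivCoord i * derivCoord i := by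
    ext1 ψ
    rw [bessel_apply]
    ext x
    simp [RCLike.real_smul_eq_coe_mul, derivCoord_eq]
  rw [h]
  exact sub_mem (one_mem _) (Subalgebra.smul_mem _ (sum_mem fun i _ =>
    mul_mem (derivCoord_mem_tame i) (derivCoord_mem_tame i)) _)

/-- By the Sobolev embedding the supremum is dominated by the `L²` norm, bounded with degree `0`,
composed with a power of the tame operator `bessel`. -/
lemma polyBounded_seminorm_zero :
    PolyBounded (SchwartzMap.seminorm 𝕜 0 0 : Seminorm 𝕜 𝓢(Space N, 𝕜)) := by
  obtain ⟨k, C, hC, hb⟩ := exists_seminorm_le_bessel N 𝕜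
  have h1 : PolyBounded ((C.toNNReal : NNReal) •
      (normSeminorm 𝕜 (FlatL2 N 𝕜)).comp (embL2 N 𝕜).toLinearMap) :=
    ⟨C, 0, hC, fun n w _ => by
      simp [NNReal.smul_def, hC]⟩
  refine (pow_mem (bessel_mem_tame (N := N) (𝕜 := 𝕜)) k _ h1).mono fun w => ?_
  refine (hb w).trans_eq ?_
  have : (bessel N 𝕜 ^ k) w = (bessel N 𝕜)^[k] w := by rw [FunLike.coe_pow_eq_iterate]
  simp only [Seminorm.comp_apply, smul_apply, NNReal.smul_def, Real.coe_toNNReal _ hC,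
    ContinuousLinearMap.coe_coe, this, coe_normSeminorm, smul_eq_mul]
  rfl

/-- On the Hermite spaces, the Schwartz seminorms grow at most polynomially. -/
lemma polyBounded_seminorm (k n : ℕ) :
    PolyBounded (SchwartzMap.seminorm 𝕜 k n : Seminorm 𝕜 𝓢(Space N, 𝕜)) := by
  choose T hT h using fun I : Fin n → Fin N =>
    exists_tame_iteratedLineDerivOp (𝕜 := 𝕜) I
  obtain ⟨R, hR, h'⟩ := exists_tame_norm_sq_pow (N := N) (𝕜 := 𝕜) k
  have h1 : PolyBounded (∑ I : Fin n → Fin N,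
      ((SchwartzMap.seminorm 𝕜 0 0 : Seminorm 𝕜 𝓢(Space N, 𝕜)).comp (T I).toLinearMap +
        (SchwartzMap.seminorm 𝕜 0 0 : Seminorm 𝕜 𝓢(Space N, 𝕜)).comp (R * T I).toLinearMap)) :=
    PolyBounded.sum fun I _ => (hT I _ polyBounded_seminorm_zero).add
      (mul_mem hR (hT I) _ polyBounded_seminorm_zero)
  refine h1.mono fun w => (seminorm_le_sum k n w).trans_eq ?_
  rw [_root_.sum_apply]
  refine Finset.sum_congr rfl fun I _ => ?_
  rw [h, h']
  rfl

end PolynomialBounds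

/-! ### Totality of the Hermite functions -/

section Completeness

open SchwartzMap LineDeriv FourierTransform
open scoped InnerProductSpace ComplexConjugate

/-- Injectivity of the Fourier transform on `L¹`: a test function `g` is the transform of the
Schwartz function `𝓕⁻ g`, and the transform moves to `v` under the integral. -/
lemma ae_eq_zero_of_fourier_eq_zero {E : Type*} [NormedAddCommGroup E] [InnerProductSpace ℝ E]
    [FiniteDimensional ℝ E] [MeasurableSpace E] [BorelSpace E] {v : E → ℂ}
    (hv : Integrable v) (h : ∀ t, 𝓕 v t = 0) : ∀ᵐ x, v x = 0 := by
  refine ae_eq_zero_of_integral_contDiff_smul_eq_zero hv.locallyIntegrable fun g hg hgs => ?_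
  let φ : 𝓢(E, ℂ) := HasCompactSupport.toSchwartzMap (f := fun x => ((g x : ℝ) : ℂ))
    (hgs.comp_left (g := fun r : ℝ => (r : ℂ)) (by simp)) (Complex.ofRealCLM.contDiff.comp hg)
  have h1 := VectorFourier.integral_fourierIntegral_smul_eq_flip (L := innerₗ E)
    Real.continuous_fourierChar continuous_inner (𝓕⁻ φ).integrable hv (μ := volume) (ν := volume)
  have h2 : ∀ x, VectorFourier.fourierIntegral Real.fourierChar volume (innerₗ E).flip v x = 0 := by
    intro x
    rw [flip_innerₗ]
    exact h x
  have h3 : VectorFourier.fourierIntegral Real.fourierChar volume (innerₗ E)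
      (⇑(𝓕⁻ φ : 𝓢(E, ℂ))) = φ := by
    have : 𝓕 (𝓕⁻ φ) = φ := FourierTransform.fourier_fourierInv_eq φ
    exact congrArg (fun ψ : 𝓢(E, ℂ) => (ψ : E → ℂ)) this
  rw [h3] at h1
  simp only [h2, smul_zero, integral_zero] at h1
  rw [← h1]
  rfl

/-- Expanding the character in its power series expresses `𝓕 v` through the vanishing moments.
Exponential integrability is what allows summation and integration to be exchanged. -/
lemma ae_eq_zero_of_moments_eq_zero {E : Type*} [NormedAddCommGroup E] [InnerProductSpace ℝ E]
    [FiniteDimensional ℝ E] [MeasurableSpace E] [BorelSpace E] {v : E → ℂ}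
    (hv : Integrable v) (hexp : ∀ c : ℝ, Integrable fun x => Real.exp (c * ‖x‖) * ‖v x‖)
    (h : ∀ (t : E) (k : ℕ), ∫ x, ((inner ℝ x t : ℝ) : ℂ) ^ k * v x = 0) : ∀ᵐ x, v x = 0 := by
  refine ae_eq_zero_of_fourier_eq_zero hv fun t => ?_
  rw [Real.fourier_eq']
  let F : ℕ → E → ℂ := fun k x =>
    ((-2 * Real.pi * inner ℝ x t : ℝ) * Complex.I) ^ k / k.factorial * v x
  have hs := hasSum_integral_of_dominated_convergence (μ := (volume : Measure E)) (F := F)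
    (f := fun x => Complex.exp ((-2 * Real.pi * inner ℝ x t : ℝ) * Complex.I) • v x)
    (fun k x => (2 * Real.pi * ‖t‖ * ‖x‖) ^ k / k.factorial * ‖v x‖)
    (fun k => by
      refine AEStronglyMeasurable.mul ?_ hv.aestronglyMeasurable
      exact Continuous.aestronglyMeasurable (by fun_prop))
    (fun k => Eventually.of_forall fun x => by
      have h1 : ‖((-2 * Real.pi * inner ℝ x t : ℝ) : ℂ) * Complex.I‖ ≤
          2 * Real.pi * ‖t‖ * ‖x‖ := by
        rw [norm_mul, Complex.norm_I, mul_one, Complex.norm_real, norm_mul, norm_mul, norm_neg,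
          Real.norm_ofNat, Real.norm_of_nonneg Real.pi_pos.le, mul_assoc _ ‖t‖, mul_comm ‖t‖]
        gcongr
        exact norm_inner_le_norm x t
      simp only [F]
      rw [norm_mul, norm_div, norm_pow, Complex.norm_natCast]
      gcongr)
    (Eventually.of_forall fun x =>
      (Real.summable_pow_div_factorial _).mul_right _)
    (by
      refine (hexp (2 * Real.pi * ‖t‖)).congr (Eventually.of_forall fun x => ?_)
      simp only
      rw [tsum_mul_right, Real.exp_eq_exp_ℝ, NormedSpace.exp_eq_tsum_div])
    (Eventually.of_forall fun x => by
      have := NormedSpace.expSeries_div_hasSum_exp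
        (((-2 * Real.pi * inner ℝ x t : ℝ) : ℂ) * Complex.I)
      rw [← Complex.exp_eq_exp_ℂ] at this
      exact this.mul_right (v x))
  refine hs.unique ?_
  have h0 : ∀ k, ∫ x, F k x = 0 := by
    intro k
    have : F k = fun x => ((-2 * Real.pi * Complex.I) ^ k / k.factorial : ℂ) *
        (((inner ℝ x t : ℝ) : ℂ) ^ k * v x) := by
      ext x
      simp only [F]
      push_cast
      ring
    rw [this, integral_const_mul, h, mul_zero]
  simp only [h0]
  exact hasSum_zero

variable {N : ℕ} {𝕜 : Type*} [RCLike 𝕜]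

lemma memLp_exp_mul_sqrt_density (N : ℕ) (c : ℝ) :
    MemLp (fun x : Space N => Real.exp (c * ‖x‖) * Real.sqrt (density N x)) 2 volume := by
  have hcont : Continuous fun x : Space N => Real.exp (c * ‖x‖) * Real.sqrt (density N x) :=
    (by fun_prop : Continuous fun x : Space N => Real.exp (c * ‖x‖)).mul
      (contDiff_sqrt_density N).continuous
  rw [memLp_two_iff_integrable_sq hcont.aestronglyMeasurable]
  have h1 : Integrable (fun x : Space N => Real.exp (-‖x‖ ^ 2 / 4)) volume := by
    have := (GaussianFourier.integrable_cexp_neg_mul_sq_norm_add (V := Space N) (b := 1 / 4)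
      (by norm_num) 0 0).norm
    refine this.congr (Eventually.of_forall fun x => ?_)
    simp only [Complex.norm_exp]
    congr 1
    simp [← Complex.ofReal_pow]
    ring
  refine (h1.const_mul (Real.exp (4 * c ^ 2) * (2 * Real.pi) ^ (-(N : ℝ) / 2))).mono'
    (hcont.pow 2).aestronglyMeasurable (Eventually.of_forall fun x => ?_)
  rw [Real.norm_of_nonneg (by positivity), mul_pow, Real.sq_sqrt (density_pos N x).le, density,
    ← Real.exp_nat_mul]
  calc Real.exp (((2 : ℕ) : ℝ) * (c * ‖x‖)) *
        ((2 * Real.pi) ^ (-(N : ℝ) / 2) * Real.exp (-‖x‖ ^ 2 / 2))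
      = (2 * Real.pi) ^ (-(N : ℝ) / 2) *
        Real.exp (((2 : ℕ) : ℝ) * (c * ‖x‖) + -‖x‖ ^ 2 / 2) := by rw [Real.exp_add]; ring
    _ ≤ (2 * Real.pi) ^ (-(N : ℝ) / 2) * Real.exp (4 * c ^ 2 + -‖x‖ ^ 2 / 4) := by
        -- The difference of the two sides is the square `(‖x‖/2 - 2c)²`.
        have h2 : ((2 : ℕ) : ℝ) * (c * ‖x‖) + -‖x‖ ^ 2 / 2 ≤ 4 * c ^ 2 + -‖x‖ ^ 2 / 4 := by
          push_cast
          nlinarith [sq_nonneg (‖x‖ - 4 * c)]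
        have := Real.exp_le_exp.2 h2
        gcongr
    _ = _ := by rw [Real.exp_add]; ring

lemma mulCoord_mem_iSup (i : Fin N) {w : 𝓢(Space N, 𝕜)} (hw : w ∈ ⨆ n, hermiteSpace N 𝕜 n) :
    mulCoord i w ∈ ⨆ n, hermiteSpace N 𝕜 n := by
  refine Submodule.iSup_induction (hermiteSpace N 𝕜)
    (motive := fun w => mulCoord i w ∈ ⨆ n, hermiteSpace N 𝕜 n) hw (fun n v hv => ?_) (by simp)
    fun v w hv hw => by rw [map_add]; exact add_mem hv hw
  rw [mulCoord_eq]
  refine add_mem ?_ (Submodule.mem_iSup_of_mem (n + 1) (creat_mem i hv))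
  rcases n with _ | n
  · rw [annih_eq_zero i hv]
    exact zero_mem _
  · exact Submodule.mem_iSup_of_mem n (annih_mem i hv)

/-- The span of the Hermite spaces is stable under multiplication by coordinates. Hence the moments
of `(p^N)^{1/2} u` are inner products of `u` with elements of that span. -/
lemma exists_mem_iSup_inner_pow (t : Space N) (k : ℕ) : ∃ w ∈ ⨆ n, hermiteSpace N 𝕜 n,
    ∀ x, w x = ((inner ℝ x t ^ k * Real.sqrt (density N x) : ℝ) : 𝕜) := by
  induction k with
  | zero => exact ⟨ground N 𝕜, Submodule.mem_iSup_of_mem 0 ground_mem, fun x => by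
      rw [ground_apply, pow_zero, one_mul]⟩
  | succ k ih =>
    obtain ⟨w, hw, h⟩ := ih
    refine ⟨∑ i, (t i : 𝕜) • mulCoord i w, sum_mem fun i _ =>
      Submodule.smul_mem _ _ (mulCoord_mem_iSup i hw), fun x => ?_⟩
    have h1 : inner ℝ x t = ∑ i, t i * x i := by
      simp [PiLp.inner_apply]
    rw [_root_.sum_apply]
    simp only [smul_apply, mulCoord_apply, h, smul_eq_mul]
    rw [pow_succ', mul_assoc, RCLike.ofReal_mul (inner ℝ x t), h1]
    simp only [RCLike.ofReal_sum, RCLike.ofReal_mul (t _), Finset.sum_mul]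
    refine Finset.sum_congr rfl fun i _ => ?_
    ring

/-- The Hermite functions are total in `L²(dx)`. -/
lemma eq_zero_of_inner_hermiteSpace {u : FlatL2 N 𝕜}
    (h : ∀ n, ∀ w ∈ hermiteSpace N 𝕜 n, ⟪embL2 N 𝕜 w, u⟫_𝕜 = 0) : u = 0 := by
  have h' : ∀ w ∈ ⨆ n, hermiteSpace N 𝕜 n, ⟪embL2 N 𝕜 w, u⟫_𝕜 = 0 := fun w hw =>
    Submodule.iSup_induction (hermiteSpace N 𝕜) (motive := fun w => ⟪embL2 N 𝕜 w, u⟫_𝕜 = 0) hw h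
      (by simp) fun v w hv hw => by rw [map_add, inner_add_left, hv, hw, add_zero]
  let L := RCLike.map 𝕜 ℂ
  let v : Space N → ℂ := fun x => Real.sqrt (density N x) • L (u x)
  have hLu : MemLp (fun x => ‖u x‖) 2 volume := (Lp.memLp u).norm
  have hmeas : AEStronglyMeasurable v volume :=
    (contDiff_sqrt_density N).continuous.aestronglyMeasurable.smul
      (L.continuous.comp_aestronglyMeasurable (Lp.aestronglyMeasurable u))
  have hnorm : ∀ x, ‖v x‖ = Real.sqrt (density N x) * ‖u x‖ := fun x => by
    rw [norm_smul, norm_toComplex, Real.norm_of_nonneg (Real.sqrt_nonneg _)]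
  have hexp : ∀ c : ℝ, Integrable (fun x => Real.exp (c * ‖x‖) * ‖v x‖) volume := fun c =>
    ((memLp_exp_mul_sqrt_density N c).integrable_mul hLu).congr
      (Eventually.of_forall fun x => by simp only [Pi.mul_apply, hnorm, mul_assoc])
  have hv : Integrable v volume :=
    (hexp 0).mono hmeas (Eventually.of_forall fun x => by simp)
  have hv0 := ae_eq_zero_of_moments_eq_zero hv hexp fun t k => by
    obtain ⟨w, hw, hwx⟩ := exists_mem_iSup_inner_pow (𝕜 := 𝕜) t k
    have h1 := h' w hw
    rw [inner_embL2] at h1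
    have h2 : Integrable (fun x => conj (w x) * u x) volume := by
      refine MemLp.integrable_mul (p := 2) (q := 2) ?_ (Lp.memLp u)
      exact (w.memLp 2 volume).star
    have h3 := L.integral_comp_comm h2
    rw [h1, map_zero] at h3
    rw [← h3]
    congr 1
    ext x
    rw [hwx, RCLike.conj_ofReal, ← RCLike.real_smul_eq_coe_mul, map_smul, mul_smul]
    simp only [v, Complex.real_smul]
    push_cast
    rfl
  refine (Lp.eq_zero_iff_ae_eq_zero).2 ?_
  filter_upwards [hv0] with x hx
  have h4 := hnorm x
  rw [hx, norm_zero] at h4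
  have h5 := Real.sqrt_pos.2 (density_pos N x)
  rcases mul_eq_zero.1 h4.symm with h6 | h6
  · exact absurd h6 h5.ne'
  · simpa using h6

end Completeness

/-! ### Hermite expansions in `L²(dx)` and in the Schwartz space -/

section Expansion

open SchwartzMap
open scoped InnerProductSpace ComplexConjugate

variable {N : ℕ} {𝕜 : Type*} [RCLike 𝕜]

/-- Eigenvectors of the symmetric operator `H` for distinct eigenvalues are orthogonal. -/
lemma inner_hermiteSpace_eq_zero {m n : ℕ} (hmn : m ≠ n) {v w : 𝓢(Space N, 𝕜)}
    (hv : v ∈ hermiteSpace N 𝕜 m) (hw : w ∈ hermiteSpace N 𝕜 n) :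
    ⟪embL2 N 𝕜 v, embL2 N 𝕜 w⟫_𝕜 = 0 := by
  have h := inner_number v w
  rw [number_eq hv, number_eq hw, map_smul, map_smul, inner_smul_left, inner_smul_right,
    map_natCast, ← sub_eq_zero, ← sub_mul] at h
  refine (mul_eq_zero.1 h).resolve_left ?_
  exact fun h0 => hmn (by exact_mod_cast sub_eq_zero.1 h0)

/-- The orthogonal projection of `L²(dx)` onto the Hermite functions of degree `n`. -/
def hermiteProj (N : ℕ) (𝕜 : Type*) [RCLike 𝕜] (n : ℕ) : FlatL2 N 𝕜 →L[𝕜] FlatL2 N 𝕜 :=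
  ((hermiteSpace N 𝕜 n).map (embL2 N 𝕜).toLinearMap).starProjection

lemma exists_embL2_eq_hermiteProj (n : ℕ) (u : FlatL2 N 𝕜) :
    ∃ w ∈ hermiteSpace N 𝕜 n, embL2 N 𝕜 w = hermiteProj N 𝕜 n u :=
  Submodule.starProjection_apply_mem ((hermiteSpace N 𝕜 n).map (embL2 N 𝕜).toLinearMap) u

/-- The component of `u` in the Hermite space of degree `n`, as a Schwartz function. -/
def hermiteComp (n : ℕ) (u : FlatL2 N 𝕜) : 𝓢(Space N, 𝕜) :=
  (exists_embL2_eq_hermiteProj n u).choose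

lemma hermiteComp_mem (n : ℕ) (u : FlatL2 N 𝕜) : hermiteComp n u ∈ hermiteSpace N 𝕜 n :=
  (exists_embL2_eq_hermiteProj n u).choose_spec.1

lemma embL2_hermiteComp (n : ℕ) (u : FlatL2 N 𝕜) :
    embL2 N 𝕜 (hermiteComp n u) = hermiteProj N 𝕜 n u :=
  (exists_embL2_eq_hermiteProj n u).choose_spec.2

lemma inner_hermiteProj {n : ℕ} {w : 𝓢(Space N, 𝕜)} (hw : w ∈ hermiteSpace N 𝕜 n)
    (u : FlatL2 N 𝕜) : ⟪embL2 N 𝕜 w, hermiteProj N 𝕜 n u⟫_𝕜 = ⟪embL2 N 𝕜 w, u⟫_𝕜 := by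
  have h : embL2 N 𝕜 w ∈ (hermiteSpace N 𝕜 n).map (embL2 N 𝕜).toLinearMap :=
    Submodule.mem_map_of_mem hw
  rw [hermiteProj, ← Submodule.inner_starProjection_left_eq_right,
    Submodule.starProjection_eq_self_iff.2 h]

lemma inner_hermiteProj_of_ne {m n : ℕ} (hmn : m ≠ n) {w : 𝓢(Space N, 𝕜)}
    (hw : w ∈ hermiteSpace N 𝕜 m) (u : FlatL2 N 𝕜) :
    ⟪embL2 N 𝕜 w, hermiteProj N 𝕜 n u⟫_𝕜 = 0 := by
  rw [← embL2_hermiteComp]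
  exact inner_hermiteSpace_eq_zero hmn hw (hermiteComp_mem n u)

lemma norm_hermiteProj_le (n : ℕ) (u : FlatL2 N 𝕜) : ‖hermiteProj N 𝕜 n u‖ ≤ ‖u‖ :=
  Submodule.norm_starProjection_apply_le _ u

lemma norm_hermiteProj_clm_le (n : ℕ) : ‖hermiteProj N 𝕜 n‖ ≤ 1 :=
  ContinuousLinearMap.opNorm_le_bound _ zero_le_one fun u => by
    rw [one_mul]; exact norm_hermiteProj_le n u

lemma ext_inner_hermiteSpace {u v : FlatL2 N 𝕜}
    (h : ∀ n, ∀ w ∈ hermiteSpace N 𝕜 n, ⟪embL2 N 𝕜 w, u⟫_𝕜 = ⟪embL2 N 𝕜 w, v⟫_𝕜) : u = v := by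
  rw [← sub_eq_zero]
  refine eq_zero_of_inner_hermiteSpace fun n w hw => ?_
  rw [inner_sub_right, h n w hw, sub_self]

lemma hasSum_inner_hermiteSpace {a : ℕ → 𝕜} {y : ℕ → FlatL2 N 𝕜} {z : FlatL2 N 𝕜}
    (hs : HasSum (fun n => a n • hermiteProj N 𝕜 n (y n)) z) {m : ℕ} {w : 𝓢(Space N, 𝕜)}
    (hw : w ∈ hermiteSpace N 𝕜 m) :
    ⟪embL2 N 𝕜 w, z⟫_𝕜 = a m * ⟪embL2 N 𝕜 w, y m⟫_𝕜 := by
  have h1 := hs.mapL (innerSL 𝕜 (embL2 N 𝕜 w))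
  simp only [innerSL_apply_apply] at h1
  refine h1.unique ?_
  rw [← inner_hermiteProj hw, ← inner_smul_right]
  refine hasSum_single m fun n hn => ?_
  rw [inner_smul_right, inner_hermiteProj_of_ne hn.symm hw, mul_zero]

lemma summable_one_add_pow_neg_two : Summable fun n : ℕ => ((1 + (n : ℝ)) ^ 2)⁻¹ := by
  have := (summable_nat_add_iff 1).2 (Real.summable_nat_pow_inv.2 (one_lt_two))
  refine this.congr fun n => ?_
  push_cast
  rw [add_comm]

/-- An element of `L²(dx)` with rapidly decreasing Hermite expansion is a Schwartz function. -/
lemma exists_hasSum_hermiteComp {u : FlatL2 N 𝕜}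
    (hu : ∀ M : ℕ, ∃ C : ℝ, ∀ n : ℕ, (1 + n : ℝ) ^ M * ‖hermiteProj N 𝕜 n u‖ ≤ C) :
    ∃ ψ : 𝓢(Space N, 𝕜), embL2 N 𝕜 ψ = u ∧ HasSum (fun n => hermiteComp n u) ψ := by
  obtain ⟨ψ, hψ⟩ := hasSum_of_summable_seminorm (fun n => hermiteComp n u) fun k l => by
    obtain ⟨C, M, hC, hb⟩ := polyBounded_seminorm (N := N) (𝕜 := 𝕜) k l
    -- `M` powers of `1 + n` absorb the growth of the seminorm; the two extra powers make the series
    -- summable.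
    obtain ⟨C', hC'⟩ := hu (M + 2)
    refine Summable.of_nonneg_of_le (fun n => apply_nonneg _ _) (fun n => ?_)
      (summable_one_add_pow_neg_two.mul_left (C * C'))
    have h1 := hb n _ (hermiteComp_mem n u)
    rw [embL2_hermiteComp] at h1
    have h2 := hC' n
    refine le_trans (le_of_eq rfl) (h1.trans ?_)
    rw [mul_assoc, mul_assoc]
    refine mul_le_mul_of_nonneg_left ?_ hC
    rw [← div_eq_mul_inv, le_div_iff₀ (by positivity)]
    calc _ = (1 + n : ℝ) ^ (M + 2) * ‖hermiteProj N 𝕜 n u‖ := by ring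
      _ ≤ _ := h2
  refine ⟨ψ, ?_, hψ⟩
  have h3 := hψ.mapL (embL2 N 𝕜)
  simp only [embL2_hermiteComp] at h3
  refine ext_inner_hermiteSpace fun n w hw => ?_
  have h4 := hasSum_inner_hermiteSpace (a := fun _ => 1) (y := fun _ => u) (by simpa using h3) hw
  rw [h4, one_mul]

/-- The operator `1 + H`, with `H` the number operator. -/
def oneAddNumber (N : ℕ) (𝕜 : Type*) [RCLike 𝕜] : 𝓢(Space N, 𝕜) →L[𝕜] 𝓢(Space N, 𝕜) :=
  1 + number N 𝕜

lemma inner_oneAddNumber_pow (k : ℕ) (φ ψ : 𝓢(Space N, 𝕜)) :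
    ⟪embL2 N 𝕜 ((oneAddNumber N 𝕜 ^ k) φ), embL2 N 𝕜 ψ⟫_𝕜 =
      ⟪embL2 N 𝕜 φ, embL2 N 𝕜 ((oneAddNumber N 𝕜 ^ k) ψ)⟫_𝕜 := by
  induction k generalizing φ with
  | zero => simp
  | succ k ih =>
    rw [pow_succ, mul_apply_eq_comp, ih, ← pow_succ, pow_succ', mul_apply_eq_comp]
    simp only [oneAddNumber, add_apply, one_apply_eq_self, map_add, inner_add_left,
      inner_add_right, inner_number]

lemma oneAddNumber_pow_eq (k : ℕ) {n : ℕ} {w : 𝓢(Space N, 𝕜)} (hw : w ∈ hermiteSpace N 𝕜 n) :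
    (oneAddNumber N 𝕜 ^ k) w = (((1 + n : ℝ) ^ k : ℝ) : 𝕜) • w := by
  induction k with
  | zero => simp
  | succ k ih =>
    rw [pow_succ', mul_apply_eq_comp, ih, map_smul, pow_succ]
    have : oneAddNumber N 𝕜 w = ((1 + n : ℝ) : 𝕜) • w := by
      change w + number N 𝕜 w = _
      rw [number_eq hw]
      push_cast
      rw [add_smul, one_smul]
    rw [this, smul_smul, RCLike.ofReal_mul]

/-- The Hermite expansion of a Schwartz function is rapidly decreasing. -/
lemma norm_hermiteProj_schwartz_le (k n : ℕ) (ψ : 𝓢(Space N, 𝕜)) :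
    (1 + n : ℝ) ^ k * ‖hermiteProj N 𝕜 n (embL2 N 𝕜 ψ)‖ ≤
      ‖embL2 N 𝕜 ((oneAddNumber N 𝕜 ^ k) ψ)‖ := by
  set w := hermiteComp n (embL2 N 𝕜 ψ)
  have hw : w ∈ hermiteSpace N 𝕜 n := hermiteComp_mem n _
  rw [← embL2_hermiteComp]
  change (1 + n : ℝ) ^ k * ‖embL2 N 𝕜 w‖ ≤ _
  -- Moving `(1 + H)^k` onto the eigenvector `w` produces the weight; Cauchy–Schwarz and division by
  -- `‖w‖` then finish.
  have h1 : ((((1 + n : ℝ) ^ k * ‖embL2 N 𝕜 w‖ ^ 2 : ℝ)) : 𝕜) =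
      ⟪embL2 N 𝕜 w, embL2 N 𝕜 ((oneAddNumber N 𝕜 ^ k) ψ)⟫_𝕜 := by
    rw [← inner_oneAddNumber_pow, oneAddNumber_pow_eq k hw, map_smul, inner_smul_left,
      RCLike.conj_ofReal, ← inner_hermiteProj hw, ← embL2_hermiteComp]
    change _ = _ * ⟪embL2 N 𝕜 w, embL2 N 𝕜 w⟫_𝕜
    rw [inner_self_eq_norm_sq_to_K]
    push_cast
    rfl
  have h2 := norm_inner_le_norm (𝕜 := 𝕜) (embL2 N 𝕜 w) (embL2 N 𝕜 ((oneAddNumber N 𝕜 ^ k) ψ))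
  rw [← h1, RCLike.norm_ofReal, abs_of_nonneg (by positivity)] at h2
  rcases (norm_nonneg (embL2 N 𝕜 w)).eq_or_lt with h3 | h3
  · rw [← h3, mul_zero]; exact norm_nonneg _
  · refine le_of_mul_le_mul_left ?_ h3
    linarith

/-- The convergence is in the topology of `𝓢`, so continuous functionals on `𝓢` may be applied term
by term. -/
lemma hasSum_hermiteComp (ψ : 𝓢(Space N, 𝕜)) :
    HasSum (fun n => hermiteComp n (embL2 N 𝕜 ψ)) ψ := by
  obtain ⟨φ, hφ, hs⟩ := exists_hasSum_hermiteComp (u := embL2 N 𝕜 ψ) fun M =>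
    ⟨_, fun n => norm_hermiteProj_schwartz_le M n ψ⟩
  rwa [embL2_injective hφ] at hs

/-- The functions `m(H)` of the number operator with summable `m`. -/
def multiplier (N : ℕ) (𝕜 : Type*) [RCLike 𝕜] (m : ℕ → ℝ) : FlatL2 N 𝕜 →L[𝕜] FlatL2 N 𝕜 :=
  ∑' n, ((m n : ℝ) : 𝕜) • hermiteProj N 𝕜 n

lemma inner_multiplier {m : ℕ → ℝ} (hm : Summable m) (u : FlatL2 N 𝕜) {n : ℕ}
    {w : 𝓢(Space N, 𝕜)} (hw : w ∈ hermiteSpace N 𝕜 n) :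
    ⟪embL2 N 𝕜 w, multiplier N 𝕜 m u⟫_𝕜 = (m n : 𝕜) * ⟪embL2 N 𝕜 w, u⟫_𝕜 := by
  have h1 : Summable fun n => ((m n : ℝ) : 𝕜) • hermiteProj N 𝕜 n := by
    refine Summable.of_norm_bounded hm.norm fun n => ?_
    rw [norm_smul, RCLike.norm_ofReal, Real.norm_eq_abs]
    exact mul_le_of_le_one_right (abs_nonneg _) (norm_hermiteProj_clm_le n)
  have h2 := h1.hasSum.mapL (ContinuousLinearMap.apply 𝕜 (FlatL2 N 𝕜) u)
  exact hasSum_inner_hermiteSpace (a := fun n => (m n : 𝕜)) (y := fun _ => u) h2 hw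

end Expansion

/-! ### From the Gaussian to the Lebesgue side: `L` as the number operator -/

section Transfer

open SchwartzMap
open scoped InnerProductSpace ComplexConjugate ENNReal

variable {N : ℕ} {𝕜 : Type*} [RCLike 𝕜]

lemma sqrt_density_pos (x : Space N) : 0 < Real.sqrt (density N x) :=
  Real.sqrt_pos.2 (density_pos N x)

lemma measurable_density (N : ℕ) : Measurable fun x => ENNReal.ofReal (density N x) :=
  (contDiff_density N).continuous.measurable.ennreal_ofReal

lemma gaussian_absolutelyContinuous (N : ℕ) : gaussian N ≪ volume :=
  withDensity_absolutelyContinuous _ _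

lemma volume_absolutelyContinuous (N : ℕ) : (volume : Measure (Space N)) ≪ gaussian N :=
  withDensity_absolutelyContinuous' (measurable_density N).aemeasurable
    (Eventually.of_forall fun x => by simpa using density_pos N x)

lemma integral_gaussian (f : Space N → 𝕜) :
    ∫ x, f x ∂(gaussian N) = ∫ x, density N x • f x := by
  rw [gaussian, integral_withDensity_eq_integral_toReal_smul (measurable_density N)
    (Eventually.of_forall fun x => ENNReal.ofReal_lt_top)]
  simp only [ENNReal.toReal_ofReal (density_pos N _).le]

lemma eLpNorm_gaussian (f : Space N → 𝕜) :
    eLpNorm f 2 (gaussian N) = eLpNorm (fun x => Real.sqrt (density N x) • f x) 2 volume := by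
  rw [eLpNorm_eq_lintegral_rpow_enorm_toReal two_ne_zero ENNReal.ofNat_ne_top,
    eLpNorm_eq_lintegral_rpow_enorm_toReal two_ne_zero ENNReal.ofNat_ne_top, gaussian,
    lintegral_withDensity_eq_lintegral_mul_non_measurable _ (measurable_density N)
      (Eventually.of_forall fun x => ENNReal.ofReal_lt_top)]
  congr 2
  ext x
  rw [Pi.mul_apply, enorm_smul, ENNReal.mul_rpow_of_nonneg _ _ (by simp)]
  congr 1
  rw [Real.enorm_of_nonneg (Real.sqrt_nonneg _), ENNReal.ofReal_rpow_of_nonneg (Real.sqrt_nonneg _)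
    (by simp)]
  congr 1
  simp [Real.sq_sqrt (density_pos N x).le]

lemma memLp_flat (f : L2 N 𝕜) :
    MemLp (fun x => Real.sqrt (density N x) • f x) 2 (volume : Measure (Space N)) := by
  refine ⟨(contDiff_sqrt_density N).continuous.aestronglyMeasurable.smul
    ((Lp.aestronglyMeasurable f).mono_ac (volume_absolutelyContinuous N)), ?_⟩
  rw [← eLpNorm_gaussian]
  exact Lp.eLpNorm_lt_top f

/-- The isometry `f ↦ (p^N)^{1/2} f` of `L²(μ^N)` into `L²(dx)`. -/
def flat (N : ℕ) (𝕜 : Type*) [RCLike 𝕜] : L2 N 𝕜 →ₗᵢ[𝕜] FlatL2 N 𝕜 where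
  toFun f := (memLp_flat f).toLp
  map_add' f g := by
    rw [← MemLp.toLp_add]
    refine MemLp.toLp_congr _ _ ?_
    filter_upwards [(volume_absolutelyContinuous N).ae_eq (Lp.coeFn_add f g)] with x hx
    rw [hx]
    exact smul_add _ _ _
  map_smul' c f := by
    rw [RingHom.id_apply, ← MemLp.toLp_const_smul]
    refine MemLp.toLp_congr _ _ ?_
    filter_upwards [(volume_absolutelyContinuous N).ae_eq (Lp.coeFn_smul c f)] with x hx
    rw [hx]
    exact smul_comm (Real.sqrt (density N x)) c (f x)
  norm_map' f := by
    change ‖(memLp_flat f).toLp‖ = _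
    rw [Lp.norm_toLp, ← eLpNorm_gaussian, Lp.norm_def]

lemma coeFn_flat (f : L2 N 𝕜) :
    flat N 𝕜 f =ᵐ[volume] fun x => Real.sqrt (density N x) • f x :=
  (memLp_flat f).coeFn_toLp

lemma flat_surjective : Function.Surjective (flat N 𝕜) := by
  intro u
  have h1 : (fun x => Real.sqrt (density N x) • ((Real.sqrt (density N x))⁻¹ • u x)) = u := by
    ext x
    rw [smul_smul, mul_inv_cancel₀ (sqrt_density_pos x).ne', one_smul]
  have h2 : MemLp (fun x => (Real.sqrt (density N x))⁻¹ • u x) 2 (gaussian N) := by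
    refine ⟨?_, ?_⟩
    · exact ((contDiff_sqrt_density N).continuous.inv₀
        fun x => (sqrt_density_pos x).ne').aestronglyMeasurable.smul
        ((Lp.aestronglyMeasurable u).mono_ac (gaussian_absolutelyContinuous N))
    · rw [eLpNorm_gaussian, h1]
      exact Lp.eLpNorm_lt_top u
  refine ⟨h2.toLp, Lp.ext ?_⟩
  filter_upwards [coeFn_flat h2.toLp, (volume_absolutelyContinuous N).ae_eq h2.coeFn_toLp]
    with x hx hx'
  rw [hx, hx']
  exact congrFun h1 x

/-- Division `φ ↦ (p^N)^{-1/2} φ` of test functions. -/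
def divSqrtTest (φ : Test N) : Test N where
  toFun := fun x => (Real.sqrt (density N x))⁻¹ * φ x
  contDiff' := ((contDiff_sqrt_density N).inv fun x => (sqrt_density_pos x).ne').mul φ.contDiff
  hasCompactSupport' := φ.hasCompactSupport.mul_left
  tsupport_subset' := fun _ _ => trivial

lemma mulSqrtTest_apply (φ : Test N) (x : Space N) :
    mulSqrtTest N φ x = Real.sqrt (density N x) * φ x := rfl

lemma divSqrtTest_apply (φ : Test N) (x : Space N) :
    divSqrtTest φ x = (Real.sqrt (density N x))⁻¹ * φ x := rfl

lemma mulSqrtTest_divSqrtTest (φ : Test N) : mulSqrtTest N (divSqrtTest φ) = φ := by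
  ext x
  rw [mulSqrtTest_apply, divSqrtTest_apply, mul_inv_cancel_left₀ (sqrt_density_pos x).ne']

lemma testToSchwartz_apply (φ : Test N) (x : Space N) : testToSchwartz 𝕜 φ x = ((φ x : ℝ) : 𝕜) :=
  rfl

lemma inner_testToSchwartz (φ : Test N) (u : FlatL2 N 𝕜) :
    ⟪embL2 N 𝕜 (testToSchwartz 𝕜 φ), u⟫_𝕜 = ∫ x, φ x • u x := by
  rw [inner_embL2]
  congr 1
  ext x
  rw [testToSchwartz_apply, RCLike.conj_ofReal, RCLike.real_smul_eq_coe_mul]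

/-- Distributions pair against Lebesgue measure, so the factor `(p^N)^{1/2}` contained in `flat` has
to be divided out of the test function. For the Gaussian pairing it is multiplied in instead. -/
lemma integral_smul_eq_inner (φ : Test N) (f : L2 N 𝕜) :
    ∫ x, φ x • f x = ⟪embL2 N 𝕜 (testToSchwartz 𝕜 (divSqrtTest φ)), flat N 𝕜 f⟫_𝕜 := by
  rw [inner_testToSchwartz]
  refine integral_congr_ae ?_
  filter_upwards [coeFn_flat f] with x hx
  rw [hx, divSqrtTest_apply, smul_smul, mul_right_comm,
    inv_mul_cancel₀ (sqrt_density_pos x).ne', one_mul]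

lemma integral_gaussian_smul_eq_inner (φ : Test N) (f : L2 N 𝕜) :
    ∫ x, φ x • f x ∂(gaussian N) =
      ⟪embL2 N 𝕜 (testToSchwartz 𝕜 (mulSqrtTest N φ)), flat N 𝕜 f⟫_𝕜 := by
  rw [inner_testToSchwartz, integral_gaussian]
  refine integral_congr_ae ?_
  filter_upwards [coeFn_flat f] with x hx
  rw [hx, mulSqrtTest_apply, smul_smul, smul_smul, mul_right_comm,
    Real.mul_self_sqrt (density_pos N x).le]

lemma fderiv_ofReal_apply {g : Space N → ℝ} {x : Space N} (hg : DifferentiableAt ℝ g x)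
    (v : Space N) : fderiv ℝ (fun y => ((g y : ℝ) : 𝕜)) x v = ((fderiv ℝ g x v : ℝ) : 𝕜) := by
  have := (RCLike.ofRealCLM (K := 𝕜)).hasFDerivAt.comp x hg.hasFDerivAt
  have h2 : HasFDerivAt (fun y => ((g y : ℝ) : 𝕜))
      ((RCLike.ofRealCLM (K := 𝕜)).comp (fderiv ℝ g x)) x := this
  rw [h2.fderiv]
  rfl

lemma contDiff_partialDeriv {g : Space N → ℝ} (hg : ContDiff ℝ ∞ g) (i : Fin N) :
    ContDiff ℝ ∞ (partialDeriv i g) :=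
  (hg.fderiv_right (m := ∞) (by simp)).clm_apply contDiff_const

lemma annih_sqrt_density_mul_ofReal (i : Fin N) (ψ : 𝓢(Space N, 𝕜)) {g : Space N → ℝ}
    (hg : ContDiff ℝ ∞ g) (h : ∀ y, ψ y = (Real.sqrt (density N y) : 𝕜) * (g y : 𝕜))
    (x : Space N) :
    annih i ψ x = (Real.sqrt (density N x) : 𝕜) * (partialDeriv i g x : 𝕜) := by
  have hd : DifferentiableAt ℝ g x := (hg.differentiable (by simp)).differentiableAt
  rw [annih_sqrt_density_mul i ψ (fun y => ((g y : ℝ) : 𝕜)) x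
    ((RCLike.ofRealCLM (K := 𝕜)).differentiableAt.comp x hd) h, fderiv_ofReal_apply hd]
  rfl

/-- The number operator is `L` conjugated by `(p^N)^{1/2}`. -/
lemma number_mulSqrtTest (φ : Test N) (x : Space N) :
    number N 𝕜 (testToSchwartz 𝕜 (mulSqrtTest N φ)) x =
      (Real.sqrt (density N x) : 𝕜) * (ornsteinUhlenbeck φ x : 𝕜) := by
  have hφ : ContDiff ℝ ∞ φ := φ.contDiff
  have h1 := fun i => annih_sqrt_density_mul_ofReal i
    (testToSchwartz 𝕜 (mulSqrtTest N φ)) hφ fun y => by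
      rw [testToSchwartz_apply, mulSqrtTest_apply, RCLike.ofReal_mul]
  have h2 := fun i => annih_sqrt_density_mul_ofReal i
    (annih i (testToSchwartz 𝕜 (mulSqrtTest N φ))) (contDiff_partialDeriv hφ i) (h1 i)
  have h3 : ∀ (i : Fin N) (χ : 𝓢(Space N, 𝕜)), creat i χ x = (x i : 𝕜) * χ x - annih i χ x := by
    intro i χ
    rw [← mulCoord_apply, mulCoord_eq, add_apply, add_sub_cancel_left]
  rw [number_apply, _root_.sum_apply]
  simp only [h3, h1, h2, ornsteinUhlenbeck]
  push_cast
  rw [mul_add, mul_neg, Finset.mul_sum, Finset.mul_sum, ← Finset.sum_neg_distrib,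
    ← Finset.sum_add_distrib]
  refine Finset.sum_congr rfl fun i _ => ?_
  ring

lemma integral_ornsteinUhlenbeck (φ : Test N) (f : L2 N 𝕜) :
    ∫ x, ornsteinUhlenbeck φ x • f x ∂(gaussian N) =
      ⟪embL2 N 𝕜 (number N 𝕜 (testToSchwartz 𝕜 (mulSqrtTest N φ))), flat N 𝕜 f⟫_𝕜 := by
  rw [inner_embL2, integral_gaussian]
  refine integral_congr_ae ?_
  filter_upwards [coeFn_flat f] with x hx
  rw [hx, number_mulSqrtTest, map_mul, RCLike.conj_ofReal, RCLike.conj_ofReal]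
  simp only [RCLike.real_smul_eq_coe_mul]
  nth_rewrite 1 [← Real.mul_self_sqrt (density_pos N x).le]
  push_cast
  ring

lemma isOU_iff {f g : L2 N 𝕜} : IsOU f g ↔ ∀ φ : Test N,
    ⟪embL2 N 𝕜 (number N 𝕜 (testToSchwartz 𝕜 φ)), flat N 𝕜 f⟫_𝕜 =
      ⟪embL2 N 𝕜 (testToSchwartz 𝕜 φ), flat N 𝕜 g⟫_𝕜 := by
  simp only [IsOU, integral_ornsteinUhlenbeck, integral_gaussian_smul_eq_inner]
  refine ⟨fun h φ => ?_, fun h φ => h _⟩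
  have := h (divSqrtTest φ)
  rwa [mulSqrtTest_divSqrtTest] at this

lemma exists_test_add_I_smul (ψ : 𝓢(Space N, 𝕜)) (hψ : HasCompactSupport ψ) :
    ∃ φ χ : Test N, ψ = testToSchwartz 𝕜 φ + (RCLike.I : 𝕜) • testToSchwartz 𝕜 χ := by
  refine ⟨⟨fun x => RCLike.re (ψ x), (RCLike.reCLM (K := 𝕜)).contDiff.comp (ψ.smooth ⊤),
    hψ.comp_left (map_zero _), fun _ _ => trivial⟩,
    ⟨fun x => RCLike.im (ψ x), (RCLike.imCLM (K := 𝕜)).contDiff.comp (ψ.smooth ⊤),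
    hψ.comp_left (map_zero _), fun _ _ => trivial⟩, ?_⟩
  ext x
  rw [add_apply, smul_apply, testToSchwartz_apply, testToSchwartz_apply, smul_eq_mul, mul_comm]
  exact (RCLike.re_add_im (ψ x)).symm

/-- Two vectors that pair equally, through continuous operators, with all test functions do so with
all Schwartz functions. -/
lemma inner_eq_of_forall_test (S T : 𝓢(Space N, 𝕜) →L[𝕜] FlatL2 N 𝕜) {u v : FlatL2 N 𝕜}
    (h : ∀ φ : Test N, ⟪S (testToSchwartz 𝕜 φ), u⟫_𝕜 = ⟪T (testToSchwartz 𝕜 φ), v⟫_𝕜)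
    (ψ : 𝓢(Space N, 𝕜)) : ⟪S ψ, u⟫_𝕜 = ⟪T ψ, v⟫_𝕜 := by
  obtain ⟨φ, hφ, hlim⟩ := exists_compactSupport_tendsto ψ
  have h1 : ∀ m, ⟪S (φ m), u⟫_𝕜 = ⟪T (φ m), v⟫_𝕜 := by
    intro m
    obtain ⟨α, β, hαβ⟩ := exists_test_add_I_smul (φ m) (hφ m)
    rw [hαβ, map_add, map_add, map_smul, map_smul, inner_add_left, inner_add_left,
      inner_smul_left, inner_smul_left, h, h]
  have h2 := ((S.continuous.tendsto ψ).comp hlim).inner (𝕜 := 𝕜) (tendsto_const_nhds (x := u))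
  have h3 := ((T.continuous.tendsto ψ).comp hlim).inner (𝕜 := 𝕜) (tendsto_const_nhds (x := v))
  simp only [Function.comp_apply, h1] at h2 h3
  exact tendsto_nhds_unique h2 h3

lemma IsOU.inner_number {f g : L2 N 𝕜} (h : IsOU f g) (ψ : 𝓢(Space N, 𝕜)) :
    ⟪embL2 N 𝕜 (number N 𝕜 ψ), flat N 𝕜 f⟫_𝕜 = ⟪embL2 N 𝕜 ψ, flat N 𝕜 g⟫_𝕜 :=
  inner_eq_of_forall_test ((embL2 N 𝕜).comp (number N 𝕜)) (embL2 N 𝕜) (isOU_iff.1 h) ψ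

lemma isOU_of_mem {n : ℕ} {w : 𝓢(Space N, 𝕜)} (hw : w ∈ hermiteSpace N 𝕜 n) {f : L2 N 𝕜}
    (hf : flat N 𝕜 f = embL2 N 𝕜 w) : IsOU f ((((n : ℝ)) : 𝕜) • f) := by
  rw [isOU_iff]
  intro φ
  rw [map_smul, hf, DiscreteWiener.inner_number, number_eq hw, map_smul, RCLike.ofReal_natCast]

/-- Pairing the eigenvalue equation with `w ∈ E_n` gives `(n - r)⟨w, f⟩ = 0`. By totality, the
weakly defined operator has no eigenvectors other than the Hermite functions. -/
lemma IsOU.flat_eq {r : ℝ} {f : L2 N 𝕜} (h : IsOU f ((r : 𝕜) • f)) :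
    f = 0 ∨ ∃ n : ℕ, r = n ∧ flat N 𝕜 f = hermiteProj N 𝕜 n (flat N 𝕜 f) := by
  have h1 : ∀ n : ℕ, r ≠ n → ∀ w ∈ hermiteSpace N 𝕜 n, ⟪embL2 N 𝕜 w, flat N 𝕜 f⟫_𝕜 = 0 := by
    intro n hn w hw
    have h2 := h.inner_number w
    rw [number_eq hw, map_smul, inner_smul_left, map_natCast, map_smul, inner_smul_right,
      ← sub_eq_zero, ← sub_mul] at h2
    refine (mul_eq_zero.1 h2).resolve_left fun h3 => hn ?_
    rw [sub_eq_zero] at h3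
    exact_mod_cast h3.symm
  by_cases hr : ∃ n : ℕ, r = n
  · obtain ⟨n, hn⟩ := hr
    refine Or.inr ⟨n, hn, ext_inner_hermiteSpace fun m w hw => ?_⟩
    rcases eq_or_ne m n with rfl | hmn
    · rw [inner_hermiteProj hw]
    · rw [inner_hermiteProj_of_ne hmn hw]
      refine h1 m (fun h4 => hmn ?_) w hw
      rw [hn] at h4
      exact_mod_cast h4.symm
  · left
    have h5 : flat N 𝕜 f = 0 := eq_zero_of_inner_hermiteSpace fun n w hw =>
      h1 n (fun h6 => hr ⟨n, h6⟩) w hw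
    rw [← norm_eq_zero, ← (flat N 𝕜).norm_map, h5, norm_zero]

/-- Hermite functions are eigenvectors (`isOU_of_mem`) and there are no others (`IsOU.flat_eq`), so
the spectral condition need only be tested on the spaces `E_n`. -/
lemma isOUPower_iff {s : ℝ} {f g : L2 N 𝕜} : IsOUPower s f g ↔
    ∀ n : ℕ, ∀ w ∈ hermiteSpace N 𝕜 n, ⟪embL2 N 𝕜 w, flat N 𝕜 g⟫_𝕜 =
      (((1 + n : ℝ) ^ (s / 2) : ℝ) : 𝕜) * ⟪embL2 N 𝕜 w, flat N 𝕜 f⟫_𝕜 := by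
  constructor
  · intro h n w hw
    obtain ⟨e, he⟩ := flat_surjective (embL2 N 𝕜 w)
    rw [← he, LinearIsometry.inner_map_map, LinearIsometry.inner_map_map]
    exact h n e (isOU_of_mem hw he)
  · intro h r e he
    rcases he.flat_eq with rfl | ⟨n, rfl, hn⟩
    · simp
    · have := h n _ (hermiteComp_mem n (flat N 𝕜 e))
      rw [embL2_hermiteComp, ← hn] at this
      rwa [LinearIsometry.inner_map_map, LinearIsometry.inner_map_map] at this

end Transfer

/-! ### The two equivalences -/

section Characterization

open SchwartzMap
open scoped InnerProductSpace ComplexConjugate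

variable {N : ℕ} {𝕜 : Type*} [RCLike 𝕜]

lemma divSqrtTest_mulSqrtTest (φ : Test N) : divSqrtTest (mulSqrtTest N φ) = φ := by
  ext x
  rw [divSqrtTest_apply, mulSqrtTest_apply, inv_mul_cancel_left₀ (sqrt_density_pos x).ne']

lemma mulSqrt_apply (X : Distr N 𝕜) (φ : Test N) : mulSqrt X φ = X (mulSqrtTest N φ) := rfl

lemma apply_eq_mulSqrt (X : Distr N 𝕜) (φ : Test N) : X φ = mulSqrt X (divSqrtTest φ) := by
  rw [mulSqrt_apply, mulSqrtTest_divSqrtTest]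

lemma inner_testToSchwartz_embL2 (φ : Test N) (ψ : 𝓢(Space N, 𝕜)) :
    ⟪embL2 N 𝕜 (testToSchwartz 𝕜 φ), embL2 N 𝕜 ψ⟫_𝕜 = ∫ x, φ x • ψ x := by
  rw [inner_testToSchwartz]
  refine integral_congr_ae ?_
  filter_upwards [coeFn_embL2 ψ] with x hx
  rw [hx]

lemma one_le_one_add_natCast (n : ℕ) : (1 : ℝ) ≤ 1 + n := by
  linarith [(Nat.cast_nonneg n : (0 : ℝ) ≤ n)]

lemma summable_of_le_inv_pow {m : ℕ → ℝ} (h0 : ∀ n, 0 ≤ m n)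
    (h : ∀ n : ℕ, m n ≤ ((1 + (n : ℝ)) ^ 2)⁻¹) : Summable m :=
  Summable.of_nonneg_of_le h0 h summable_one_add_pow_neg_two

lemma hermiteProj_multiplier {m : ℕ → ℝ} (hm : Summable m) (n : ℕ) (u : FlatL2 N 𝕜) :
    hermiteProj N 𝕜 n (multiplier N 𝕜 m u) = ((m n : ℝ) : 𝕜) • hermiteProj N 𝕜 n u := by
  refine ext_inner_hermiteSpace fun k w hw => ?_
  rw [inner_smul_right]
  rcases eq_or_ne k n with rfl | hkn
  · rw [inner_hermiteProj hw, inner_hermiteProj hw, inner_multiplier hm _ hw]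
  · rw [inner_hermiteProj_of_ne hkn hw, inner_hermiteProj_of_ne hkn hw, mul_zero]

/-- Rapid decrease makes the weighted expansion converge in `L²`, so a constant sequence already
witnesses membership, whatever the sign of `s`. -/
lemma mem_sobolev_of_isSchwartz {X : Distr N 𝕜} (hX : IsSchwartz (mulSqrt X)) (s : ℝ) :
    X ∈ sobolev N 𝕜 s := by
  obtain ⟨ψ, hψ⟩ := hX
  obtain ⟨k, hk⟩ := exists_nat_ge (s / 2)
  have hsum : Summable fun n : ℕ =>
      (((1 + n : ℝ) ^ (s / 2) : ℝ) : 𝕜) • hermiteProj N 𝕜 n (embL2 N 𝕜 ψ) := by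
    refine Summable.of_norm_bounded (summable_one_add_pow_neg_two.mul_left
      ‖embL2 N 𝕜 ((oneAddNumber N 𝕜 ^ (k + 2)) ψ)‖) fun n => ?_
    have h1 := norm_hermiteProj_schwartz_le (k + 2) n ψ
    rw [norm_smul, RCLike.norm_ofReal, abs_of_nonneg (by positivity), ← div_eq_mul_inv,
      le_div_iff₀ (by positivity)]
    have h2 : (1 + n : ℝ) ^ (s / 2) ≤ (1 + n : ℝ) ^ k := by
      rw [← Real.rpow_natCast]
      exact Real.rpow_le_rpow_of_exponent_le (one_le_one_add_natCast n) hk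
    calc _ ≤ (1 + n : ℝ) ^ k * ‖hermiteProj N 𝕜 n (embL2 N 𝕜 ψ)‖ * (1 + n) ^ 2 := by gcongr
      _ = (1 + n : ℝ) ^ (k + 2) * ‖hermiteProj N 𝕜 n (embL2 N 𝕜 ψ)‖ := by ring
      _ ≤ _ := h1
  obtain ⟨f, hf⟩ := flat_surjective (embL2 N 𝕜 ψ)
  obtain ⟨g, hg⟩ := flat_surjective (∑' n : ℕ,
      (((1 + n : ℝ) ^ (s / 2) : ℝ) : 𝕜) • hermiteProj N 𝕜 n (embL2 N 𝕜 ψ))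
  refine ⟨fun _ => f, fun _ => g, fun _ => isOUPower_iff.2 fun n w hw => ?_, cauchySeq_const g,
    fun φ => ?_⟩
  · rw [hf, hg]
    exact hasSum_inner_hermiteSpace (a := fun n : ℕ => (((1 + n : ℝ) ^ (s / 2) : ℝ) : 𝕜))
      (y := fun _ => embL2 N 𝕜 ψ) hsum.hasSum hw
  · simp only [integral_smul_eq_inner]
    rw [hf, inner_testToSchwartz_embL2, ← hψ, ← apply_eq_mulSqrt]
    exact tendsto_const_nhds

/-- For `s/2 = M + 2` the approximants are `f_j = (1 + H)^{-(M+2)} g_j` with a bounded operator, so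
they converge in `L²` together with the `g_j`. The surplus `2` makes the multiplier sequence
summable. -/
lemma exists_of_mem_sobolev {X : Distr N 𝕜} {M : ℕ} (hX : X ∈ sobolev N 𝕜 (2 * (M + 2))) :
    ∃ u : FlatL2 N 𝕜, (∀ φ, X φ = ⟪embL2 N 𝕜 (testToSchwartz 𝕜 (divSqrtTest φ)), u⟫_𝕜) ∧
      ∃ C : ℝ, ∀ n : ℕ, (1 + n : ℝ) ^ M * ‖hermiteProj N 𝕜 n u‖ ≤ C := by
  obtain ⟨f, g, hfg, hg, hlim⟩ := hX
  obtain ⟨g', hg'⟩ := cauchySeq_tendsto_of_complete hg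
  let m : ℕ → ℝ := fun n => ((1 + n : ℝ) ^ (M + 2))⁻¹
  have hm : Summable m := summable_of_le_inv_pow (fun n => by positivity) fun n => by
    have := one_le_one_add_natCast n
    simp only [m]
    gcongr
    omega
  have hf : ∀ j, flat N 𝕜 (f j) = multiplier N 𝕜 m (flat N 𝕜 (g j)) := by
    intro j
    refine ext_inner_hermiteSpace fun n w hw => ?_
    rw [inner_multiplier hm _ hw, isOUPower_iff.1 (hfg j) n w hw, ← mul_assoc,
      ← RCLike.ofReal_mul]
    have h1 : (2 * ((M : ℝ) + 2)) / 2 = ((M + 2 : ℕ) : ℝ) := by push_cast; ring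
    rw [h1, Real.rpow_natCast, inv_mul_cancel₀ (by positivity), RCLike.ofReal_one, one_mul]
  refine ⟨multiplier N 𝕜 m (flat N 𝕜 g'), fun φ => ?_, ‖flat N 𝕜 g'‖, fun n => ?_⟩
  · refine tendsto_nhds_unique (hlim φ) ?_
    simp only [integral_smul_eq_inner, hf]
    exact tendsto_const_nhds.inner ((multiplier N 𝕜 m).continuous.tendsto _ |>.comp
      ((flat N 𝕜).continuous.tendsto _ |>.comp hg'))
  · rw [hermiteProj_multiplier hm, norm_smul, RCLike.norm_ofReal, abs_of_nonneg (by positivity),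
      ← mul_assoc]
    refine (mul_le_of_le_one_left (norm_nonneg _) ?_).trans (norm_hermiteProj_le n _)
    rw [← div_eq_mul_inv, div_le_one (by positivity)]
    exact pow_le_pow_right₀ (one_le_one_add_natCast n) (by omega)

lemma isSchwartz_of_mem_sobolevTop {X : Distr N 𝕜} (hX : X ∈ sobolevTop N 𝕜) :
    IsSchwartz (mulSqrt X) := by
  have hX' : ∀ M : ℕ, X ∈ sobolev N 𝕜 (2 * (M + 2)) := fun M => by
    rw [sobolevTop, Set.mem_iInter₂] at hX
    exact hX _ (by positivity)
  choose u hu hC using fun M => exists_of_mem_sobolev (hX' M)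
  -- All the `u M` represent the same distribution on test functions, and these determine an `L²`
  -- element.
  have huu : ∀ M, u M = u 0 := by
    intro M
    refine ext_inner_hermiteSpace fun n w _ =>
      inner_eq_of_forall_test (embL2 N 𝕜) (embL2 N 𝕜) (fun φ => ?_) w
    have h1 := hu M (mulSqrtTest N φ)
    have h2 := hu 0 (mulSqrtTest N φ)
    rw [divSqrtTest_mulSqrtTest] at h1 h2
    rw [← h1, ← h2]
  obtain ⟨ψ, hψ, -⟩ := exists_hasSum_hermiteComp (u := u 0) fun M => by
    rw [← huu M]
    exact hC M
  refine ⟨ψ, fun φ => ?_⟩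
  rw [mulSqrt_apply, hu 0, divSqrtTest_mulSqrtTest, ← hψ, inner_testToSchwartz_embL2]

/-- Complex conjugation on the Schwartz space. -/
def conjSchwartz (N : ℕ) (𝕜 : Type*) [RCLike 𝕜] : 𝓢(Space N, 𝕜) →L[ℝ] 𝓢(Space N, 𝕜) :=
  postcompCLM (RCLike.conjCLE (K := 𝕜)).toContinuousLinearMap

lemma conjSchwartz_apply (ψ : 𝓢(Space N, 𝕜)) (x : Space N) :
    conjSchwartz N 𝕜 ψ x = conj (ψ x) := rfl

lemma conjSchwartz_smul (c : 𝕜) (ψ : 𝓢(Space N, 𝕜)) :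
    conjSchwartz N 𝕜 (c • ψ) = conj c • conjSchwartz N 𝕜 ψ := by
  ext x
  simp [conjSchwartz_apply]

lemma conjSchwartz_testToSchwartz (φ : Test N) :
    conjSchwartz N 𝕜 (testToSchwartz 𝕜 φ) = testToSchwartz 𝕜 φ := by
  ext x
  rw [conjSchwartz_apply, testToSchwartz_apply, RCLike.conj_ofReal]

/-- A continuous seminorm is dominated by a multiple of a finite supremum of Schwartz seminorms. -/
lemma polyBounded_of_continuous {q : Seminorm 𝕜 𝓢(Space N, 𝕜)} (hq : Continuous q) :
    PolyBounded q := by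
  obtain ⟨s, C, -, h⟩ := Seminorm.bound_of_continuous
    (schwartz_withSeminorms 𝕜 (Space N) 𝕜) q hq
  have h1 : PolyBounded (∑ i ∈ s, schwartzSeminormFamily 𝕜 (Space N) 𝕜 i) :=
    PolyBounded.sum fun i _ => polyBounded_seminorm i.1 i.2
  obtain ⟨C', M, hC', hb⟩ := h1
  refine ⟨C * C', M, by positivity, fun n w hw => (h w).trans ?_⟩
  have h2 : (s.sup (schwartzSeminormFamily 𝕜 (Space N) 𝕜)) w ≤
      (∑ i ∈ s, schwartzSeminormFamily 𝕜 (Space N) 𝕜 i) w := Seminorm.finset_sup_le_sum _ s w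
  change (C : ℝ) * _ ≤ _
  rw [mul_assoc, mul_assoc, ← mul_assoc C']
  exact mul_le_mul_of_nonneg_left (h2.trans (hb n w hw)) C.coe_nonneg

lemma exists_riesz_hermiteSpace (V : 𝓢(Space N, 𝕜) →L[𝕜] 𝕜) (n : ℕ) :
    ∃ b ∈ hermiteSpace N 𝕜 n, ∀ w ∈ hermiteSpace N 𝕜 n,
      V w = ⟪embL2 N 𝕜 b, embL2 N 𝕜 w⟫_𝕜 := by
  let e := Submodule.equivMapOfInjective (embL2 N 𝕜).toLinearMap embL2_injective
    (hermiteSpace N 𝕜 n)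
  let l := LinearMap.toContinuousLinearMap
    (V.toLinearMap ∘ₗ (hermiteSpace N 𝕜 n).subtype ∘ₗ e.symm.toLinearMap)
  have : CompleteSpace ((hermiteSpace N 𝕜 n).map (embL2 N 𝕜).toLinearMap) :=
    FiniteDimensional.complete 𝕜 _
  let k := (InnerProductSpace.toDual 𝕜 _).symm l
  obtain ⟨b, hb, hbk⟩ := k.2
  refine ⟨b, hb, fun w hw => ?_⟩
  have h1 : ⟪k, e ⟨w, hw⟩⟫_𝕜 = l (e ⟨w, hw⟩) := InnerProductSpace.toDual_symm_apply
  have h2 : l (e ⟨w, hw⟩) = V w := by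
    change V ((e.symm (e ⟨w, hw⟩) : hermiteSpace N 𝕜 n) : 𝓢(Space N, 𝕜)) = V w
    rw [LinearEquiv.symm_apply_apply]
  rw [← h2, ← h1, Submodule.coe_inner, ← hbk]
  rfl

/-- The Riesz vectors `b n` of the distribution on the spaces `E_n` grow at most polynomially. Their
partial sums are the approximating sequence, and the weights `(1 + n)^{-(M+2)}` make it Cauchy. -/
lemma mem_sobolevBot_of_isTempered {X : Distr N 𝕜} (hX : IsTempered (mulSqrt X)) :
    X ∈ sobolevBot N 𝕜 := by
  obtain ⟨U, hU⟩ := hX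
  -- Pairing a test function with `f` puts `f` in the linear slot of the inner product, while the
  -- Riesz vector occupies the conjugate-linear one. Conjugating both argument and value keeps `V`
  -- linear and compensates for this, since test functions are real.
  let V : 𝓢(Space N, 𝕜) →L[𝕜] 𝕜 :=
    { toFun := fun ψ => conj (U (conjSchwartz N 𝕜 ψ))
      map_add' := fun φ ψ => by simp only [map_add]
      map_smul' := fun c ψ => by simp [conjSchwartz_smul]
      cont := RCLike.continuous_conj.comp (U.continuous.comp (conjSchwartz N 𝕜).continuous) }
  have hV : ∀ φ : Test N, conj (V (testToSchwartz 𝕜 φ)) = U (testToSchwartz 𝕜 φ) := fun φ => by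
    change conj (conj (U (conjSchwartz N 𝕜 (testToSchwartz 𝕜 φ)))) = _
    rw [RCLike.conj_conj, conjSchwartz_testToSchwartz]
  choose b hb hbV using exists_riesz_hermiteSpace V
  obtain ⟨C, M, hC, hq⟩ := polyBounded_of_continuous
    (q := (normSeminorm 𝕜 𝕜).comp V.toLinearMap) (continuous_norm.comp V.continuous)
  have hbn : ∀ n : ℕ, ‖embL2 N 𝕜 (b n)‖ ≤ C * (1 + n) ^ M := by
    intro n
    -- Testing the functional on its own Riesz vector gives `‖b n‖²` on the left.
    have h1 : ‖V (b n)‖ ≤ C * (1 + n) ^ M * ‖embL2 N 𝕜 (b n)‖ := hq n (b n) (hb n)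
    rw [hbV n _ (hb n), inner_self_eq_norm_sq_to_K, norm_pow, RCLike.norm_ofReal, abs_norm] at h1
    rcases (norm_nonneg (embL2 N 𝕜 (b n))).eq_or_lt with h2 | h2
    · rw [← h2]; positivity
    · refine le_of_mul_le_mul_right ?_ h2
      rwa [sq] at h1
  choose β hβ using fun n => flat_surjective (embL2 N 𝕜 (b n))
  let c : ℕ → ℝ := fun n => ((1 + n : ℝ) ^ (M + 2))⁻¹
  have hsum : Summable fun n => ((c n : ℝ) : 𝕜) • β n := by
    refine Summable.of_norm_bounded (summable_one_add_pow_neg_two.mul_left C) fun n => ?_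
    rw [norm_smul, RCLike.norm_ofReal, abs_of_nonneg (by positivity), ← (flat N 𝕜).norm_map, hβ]
    calc c n * ‖embL2 N 𝕜 (b n)‖ ≤ c n * (C * (1 + n) ^ M) := by
          have : 0 ≤ c n := by positivity
          gcongr
          exact hbn n
      _ = C * ((1 + (n : ℝ)) ^ 2)⁻¹ := by
          simp only [c]
          rw [pow_add]
          field_simp
  rw [sobolevBot, Set.mem_iUnion₂]
  refine ⟨-(2 * (M + 2)), by linarith [(Nat.cast_nonneg M : (0 : ℝ) ≤ M)],
    fun K => ∑ n ∈ Finset.range K, β n,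
    fun K => ∑ n ∈ Finset.range K, ((c n : ℝ) : 𝕜) • β n, fun K => ?_,
    hsum.hasSum.tendsto_sum_nat.cauchySeq, fun φ => ?_⟩
  · refine isOUPower_iff.2 fun m w hw => ?_
    rw [map_sum, map_sum, inner_sum, inner_sum, Finset.mul_sum]
    refine Finset.sum_congr rfl fun n _ => ?_
    rw [map_smul, hβ, inner_smul_right]
    rcases eq_or_ne m n with rfl | hmn
    · congr 2
      have h1 : (-(2 * ((M : ℝ) + 2))) / 2 = -((M + 2 : ℕ) : ℝ) := by push_cast; ring
      rw [h1, Real.rpow_neg (by positivity), Real.rpow_natCast]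
    · rw [inner_hermiteSpace_eq_zero hmn hw (hb n), mul_zero, mul_zero]
  · set t := testToSchwartz 𝕜 (divSqrtTest φ) with ht
    have h1 : ∀ K, ∫ x, φ x • (∑ n ∈ Finset.range K, β n : L2 N 𝕜) x =
        conj (∑ n ∈ Finset.range K, V (hermiteComp n (embL2 N 𝕜 t))) := by
      intro K
      rw [integral_smul_eq_inner, map_sum, inner_sum, map_sum]
      refine Finset.sum_congr rfl fun n _ => ?_
      rw [hbV n _ (hermiteComp_mem n _), embL2_hermiteComp, inner_hermiteProj (hb n), hβ,
        inner_conj_symm]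
    simp only [h1]
    rw [apply_eq_mulSqrt, hU, ← hV]
    exact (RCLike.continuous_conj.tendsto _).comp
      ((hasSum_hermiteComp t).mapL V).tendsto_sum_nat

lemma inner_eq_of_forall_hermiteSpace (S T : 𝓢(Space N, 𝕜) →L[𝕜] FlatL2 N 𝕜) {u v : FlatL2 N 𝕜}
    (h : ∀ n, ∀ w ∈ hermiteSpace N 𝕜 n, ⟪u, S w⟫_𝕜 = ⟪v, T w⟫_𝕜) (ψ : 𝓢(Space N, 𝕜)) :
    ⟪u, S ψ⟫_𝕜 = ⟪v, T ψ⟫_𝕜 := by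
  have h1 := (hasSum_hermiteComp ψ).mapL ((innerSL 𝕜 u).comp S)
  have h2 := (hasSum_hermiteComp ψ).mapL ((innerSL 𝕜 v).comp T)
  simp only [ContinuousLinearMap.comp_apply, innerSL_apply_apply, h _ _ (hermiteComp_mem _ _)]
    at h1 h2
  exact h1.unique h2

/-- With `m(n) = (1 + n)^{-s/2-k}` one has `⟨φ, f_j⟩ = ⟨(1 + H)^k φ, m(H) g_j⟩`. The right side
converges with `g_j`, and its limit is continuous in `φ ∈ 𝓢`. -/
lemma isTempered_of_mem_sobolevBot {X : Distr N 𝕜} (hX : X ∈ sobolevBot N 𝕜) :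
    IsTempered (mulSqrt X) := by
  rw [sobolevBot, Set.mem_iUnion₂] at hX
  obtain ⟨s, -, f, g, hfg, hg, hlim⟩ := hX
  obtain ⟨g', hg'⟩ := cauchySeq_tendsto_of_complete hg
  -- This choice makes the exponent `-s/2 - k` at most `-2`, so that `m` is summable.
  obtain ⟨k, hk⟩ := exists_nat_ge (-(s / 2) + 2)
  let m : ℕ → ℝ := fun n => (1 + n : ℝ) ^ (-(s / 2) - k)
  have hm : Summable m := summable_of_le_inv_pow (fun n => by positivity) fun n => by
    have h1 : ((1 + (n : ℝ)) ^ 2)⁻¹ = (1 + n : ℝ) ^ (-2 : ℝ) := by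
      rw [Real.rpow_neg (by positivity)]
      norm_cast
    rw [h1]
    exact Real.rpow_le_rpow_of_exponent_le (one_le_one_add_natCast n) (by linarith)
  let S : 𝓢(Space N, 𝕜) →L[𝕜] FlatL2 N 𝕜 := (embL2 N 𝕜).comp (oneAddNumber N 𝕜 ^ k)
  have hS : ∀ j ψ, ⟪S ψ, multiplier N 𝕜 m (flat N 𝕜 (g j))⟫_𝕜 =
      ⟪embL2 N 𝕜 ψ, flat N 𝕜 (f j)⟫_𝕜 := by
    intro j ψ
    rw [← inner_conj_symm, inner_eq_of_forall_hermiteSpace S (embL2 N 𝕜) (v := flat N 𝕜 (f j)),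
      inner_conj_symm]
    intro n w hw
    rw [← inner_conj_symm, ← inner_conj_symm (flat N 𝕜 (f j))]
    congr 1
    change ⟪embL2 N 𝕜 ((oneAddNumber N 𝕜 ^ k) w), _⟫_𝕜 = _
    rw [oneAddNumber_pow_eq k hw, map_smul, inner_smul_left, RCLike.conj_ofReal,
      inner_multiplier hm _ hw, isOUPower_iff.1 (hfg j) n w hw, ← mul_assoc, ← mul_assoc,
      ← RCLike.ofReal_mul, ← RCLike.ofReal_mul]
    have h1 : (0 : ℝ) < 1 + n := by positivity
    have h2 : (1 + n : ℝ) ^ k * m n * (1 + n : ℝ) ^ (s / 2) = 1 := by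
      simp only [m]
      rw [← Real.rpow_natCast, ← Real.rpow_add h1, ← Real.rpow_add h1]
      simp
    rw [h2, RCLike.ofReal_one, one_mul]
  let U : 𝓢(Space N, 𝕜) →L[𝕜] 𝕜 :=
    { toFun := fun ψ => ⟪S (conjSchwartz N 𝕜 ψ), multiplier N 𝕜 m (flat N 𝕜 g')⟫_𝕜
      map_add' := fun φ ψ => by simp only [map_add, inner_add_left]
      map_smul' := fun c ψ => by
        simp [conjSchwartz_smul, inner_smul_left]
      cont := (S.continuous.comp (conjSchwartz N 𝕜).continuous).inner continuous_const }
  refine ⟨U, fun φ => ?_⟩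
  rw [mulSqrt_apply]
  refine tendsto_nhds_unique (hlim _) ?_
  simp only [integral_smul_eq_inner, divSqrtTest_mulSqrtTest, ← hS]
  change Tendsto _ _ (𝓝 ⟪S (conjSchwartz N 𝕜 (testToSchwartz 𝕜 φ)), _⟫_𝕜)
  rw [conjSchwartz_testToSchwartz]
  exact tendsto_const_nhds.inner ((multiplier N 𝕜 m).continuous.tendsto _ |>.comp
    ((flat N 𝕜).continuous.tendsto _ |>.comp hg'))

end Characterization
end DiscreteWiener
end

theorem proposition2p2 (𝕜 : Type*) [RCLike 𝕜] (N : ℕ) (X : DiscreteWiener.Distr N 𝕜) :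
    (DiscreteWiener.IsSchwartz (DiscreteWiener.mulSqrt X) ↔
      X ∈ DiscreteWiener.sobolevTop N 𝕜) ∧
    (DiscreteWiener.IsTempered (DiscreteWiener.mulSqrt X) ↔
      X ∈ DiscreteWiener.sobolevBot N 𝕜) :=
  ⟨⟨fun h => Set.mem_iInter₂.2 fun s _ => DiscreteWiener.mem_sobolev_of_isSchwartz h s,
    DiscreteWiener.isSchwartz_of_mem_sobolevTop⟩,
    ⟨DiscreteWiener.mem_sobolevBot_of_isTempered, DiscreteWiener.isTempered_of_mem_sobolevBot⟩⟩
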